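/- Let $n\ge 1$, let $F_1\in\mathbb{Z}[X_1],\dots,F_n\in\mathbb{Z}[X_n]$ be nonzero univariate polynomials of degree at most $M$ and bitsize at most $\Lambda$, and let $F\in\mathbb{Z}[X_1,\dots,X_n,Y]$ be a nonzero polynomial of total degree at most $d$ and bitsize at most $\tau$, where the bitsize of a polynomial is the logarithm of the largest absolute value of its coefficients; all logarithms are to base $2$. Let $\mathcal I=\langle F_1,\dots,F_n\rangle\subset\mathbb{Z}[X_1,\dots,X_n]$, let $V_{\mathbb C}(\mathcal I)\subset\mathbb{C}^n$ be its complex variety, and let $\mu_{\mathcal I}(x)$ be the multiplicity of $x\in V_{\mathbb C}(\mathcal I)$ as a root of $\mathcal I$, that is, the complex dimension of $\mathcal{O}_x/\mathcal I\mathcal{O}_x$, where $\mathcal{O}_x$ is the local ring of $\mathbb{C}^n$ at $x$. For $x\in V_{\mathbb C}(\mathcal I)$ put $F_x(Y)=F(x,Y)\in\mathbb{C}[Y]$. For a nonzero $f\in\mathbb{C}[Y]$ let $V_{\mathbb C}(f)$ be its set of distinct roots, $\mu_f(y)$ the multiplicity of the root $y$, $f^{[k]}=f^{(k)}/k!$,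 $\mathrm{sep}(y,f)=\min\{|z-y| : z\in V_{\mathbb C}(f),\ z\ne y\}$, and $$\mathrm{lGDisc}(f)=\sum_{y\in V_{\mathbb C}(f)}\mu_f(y)\,\bigl|\log|f^{[\mu_f(y)]}(y)|\bigr|,\qquad \mathrm{lsep}(f)=\sum_{y\in V_{\mathbb C}(f)}\mu_f(y)\,\bigl|\log \mathrm{sep}(y,f)\bigr|,$$ with the conventions that $\mathrm{lsep}(f)=0$ if $f$ has at most one distinct root, and $\mathrm{lGDisc}(0)=\mathrm{lsep}(0)=0$. Then $V_{\mathbb C}(\mathcal I)$ is finite, and $$\sum_{x\in V_{\mathbb C}(\mathcal I)}\mu_{\mathcal I}(x)\,\mathrm{lGDisc}(F_x)\in\widetilde{\mathcal O}\bigl(dM^n(n+\tau+d)+nd^2M^{n-1}\Lambda\bigr),$$ $$\sum_{x\in V_{\mathbb C}(\mathcal I)}\mu_{\mathcal I}(x)\,\mathrm{lsep}(F_x)\in\widetilde{\mathcal O}\bigl(dM^n(n+\tau+d)+nd^2M^{n-1}\Lambda\bigr).$$ Here $\widetilde{\mathcal O}(B)$ means: at most $C\cdot B\cdot\bigl(\log(2+n+M+d+\tau+\Lambda)\bigr)^k$,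 where $C>0$ and $k\in\mathbb{N}$ are absolute constants, independent of $n,M,d,\Lambda,\tau$ and of the polynomials. -/

import Mathlib

noncomputable section

namespace AmortizedBounds

/-! ### Size of integer polynomials

All logarithms are to base 2. -/

/-- The bitsize of a univariate integer polynomial: the base-2 logarithm of the largest absolute
value of its coefficients. -/
def bitsize (f : Polynomial ℤ) : ℝ := Real.logb 2 f.supNorm

/-- The largest absolute value of the coefficients of a multivariate integer polynomial. -/
def mvSupNorm {σ : Type*} (p : MvPolynomial σ ℤ) : ℕ :=
  p.support.sup fun m => (p.coeff m).natAbs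

/-- The bitsize of a multivariate integer polynomial. -/
def mvBitsize {σ : Type*} (p : MvPolynomial σ ℤ) : ℝ := Real.logb 2 (mvSupNorm p)

/-- A univariate integer polynomial of size `(M, Λ)`: degree at most `M`, bitsize at most `Λ`. -/
def HasSize (f : Polynomial ℤ) (M : ℕ) (Λ : ℝ) : Prop :=
  f.natDegree ≤ M ∧ bitsize f ≤ Λ

/-- A multivariate integer polynomial of size `(d, τ)`: total degree at most `d`, bitsize at
most `τ`. -/
def MvHasSize {σ : Type*} (p : MvPolynomial σ ℤ) (d : ℕ) (τ : ℝ) : Prop :=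
  p.totalDegree ≤ d ∧ mvBitsize p ≤ τ

/-! ### Univariate complex polynomials -/

/-- The local separation of `f` at `x`: the least distance from `x` to another root of `f`.
(If there is no other root, the value is `sInf ∅ = 0`, whose logarithm is `0`.) -/
def sep (x : ℂ) (f : Polynomial ℂ) : ℝ :=
  sInf ((fun y : ℂ => ‖y - x‖) '' {y : ℂ | f.IsRoot y ∧ y ≠ x})

/-- `lGDisc f = ∑ μ(x) |log |f^[μ(x)](x)||` over the distinct complex roots `x` of `f`, where
`μ(x)` is the multiplicity of `x` and `f^[k]` is the `k`-th derivative of `f` divided by `k!`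
(the Hasse derivative). The sum is empty for `f = 0`. -/
def lGDisc (f : Polynomial ℂ) : ℝ :=
  ∑ x ∈ f.roots.toFinset, (f.rootMultiplicity x : ℝ) *
    |Real.logb 2 ‖(Polynomial.hasseDeriv (f.rootMultiplicity x) f).eval x‖|

/-- `lsep f = ∑ μ(x) |log sep(x, f)|` over the distinct complex roots `x` of `f`.
The sum is empty for `f = 0`. -/
def lsep (f : Polynomial ℂ) : ℝ :=
  ∑ x ∈ f.roots.toFinset, (f.rootMultiplicity x : ℝ) * |Real.logb 2 (sep x f)|

/-! ### Ideals, complex varieties and multiplicities -/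

/-- The extension to `ℂ[X]` of an ideal of `ℤ[X]`. -/
def complexExt {σ : Type*} (I : Ideal (MvPolynomial σ ℤ)) : Ideal (MvPolynomial σ ℂ) :=
  I.map (MvPolynomial.map (Int.castRingHom ℂ))

/-- The complex variety of an ideal of `ℤ[X]`. -/
def complexVariety {σ : Type*} (I : Ideal (MvPolynomial σ ℤ)) : Set (σ → ℂ) :=
  MvPolynomial.zeroLocus ℂ (complexExt I)

/-- The local ring at the point `x` of affine space: the localization of `ℂ[X]` at the maximal
ideal of the polynomials vanishing at `x`. -/
abbrev LocalRingAt {σ : Type*} (x : σ → ℂ) : Type _ :=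
  Localization.AtPrime (MvPolynomial.vanishingIdeal ℂ ({x} : Set (σ → ℂ)))

/-- The multiplicity of `x` as a root of the ideal `I`: the complex dimension of the quotient of
the local ring at `x` by the ideal that `I` generates there. -/
def rootMult {σ : Type*} (I : Ideal (MvPolynomial σ ℤ)) (x : σ → ℂ) : ℕ :=
  Module.finrank ℂ
    (LocalRingAt x ⧸
      (complexExt I).map (algebraMap (MvPolynomial σ ℂ) (LocalRingAt x)))

/-! ### The polynomial system -/

/-- The ideal `⟨F₁(X₁), …, Fₙ(Xₙ)⟩` of `ℤ[X₁, …, Xₙ]`. -/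
def systemIdeal {n : ℕ} (Fs : Fin n → Polynomial ℤ) : Ideal (MvPolynomial (Fin n) ℤ) :=
  Ideal.span (Set.range fun i => Polynomial.aeval (MvPolynomial.X i) (Fs i))

/-- The univariate polynomial `F_x(Y) = F(x, Y)` for `F ∈ ℤ[X₁, …, Xₙ, Y]`. The variable `Y` has
the index `none` and the variable `Xᵢ` has the index `some i`. -/
def specialize {n : ℕ} (F : MvPolynomial (Option (Fin n)) ℤ) (x : Fin n → ℂ) : Polynomial ℂ :=
  MvPolynomial.aeval
    (fun o : Option (Fin n) => o.elim Polynomial.X fun i => Polynomial.C (x i)) F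

end AmortizedBounds

end

/-!
The ideal is generated by univariate polynomials, so its variety is the grid of tuples of roots of
the `Fᵢ`, and a local quotient is spanned by the monomials in `Xᵢ - xᵢ` with exponents below the
multiplicities of the `xᵢ` (`rootMult_le_gridCount`). The weighted sums over the variety are
therefore at most sums over all tuples of roots, taken with multiplicity.

For a single polynomial `f` of degree `δ` with leading coefficient `c`, let
`gdisc f = ∏ f^[μ(y)](y)`, over the roots with multiplicity. Mahler measure bounds give
`lGDisc f` and `lsep f` at most
`O(δ²) + O(δ log⁺ ‖f‖₁) - 4 log |c ^ δ| - log |c ^ δ gdisc f|` (`lGDisc_le`, `lsep_le`); for `lsep`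
one uses that `f^[μ(y)](y)` is `c` times the product of the differences `y - z`, of which the
smallest has absolute value `sep(y, f)`. It remains to bound, on average over the grid, the size of
`F_x` from above and the two negated logarithms from below.

*Upper bound* (`sum_logSize_le`). The coefficients of `F_x` are at most
`‖F‖ max(1, |x₁|, …, |xₙ|) ^ d` up to the number of monomials. The logarithm of
this maximum is at most `log (2n) + ∑ᵢ log⁺ (|xᵢ| / 2n)`, and the Mahler measure of `Fᵢ(2n X)`
bounds the last sum, on average, without loss depending on the degrees of the `Fᵢ`.

*Lower bound* (`sum_log_norm_grid_ge`). The numbers `c ^ δ` and `c ^ δ gdisc F_x` depend on `x` in a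
way compatible with automorphisms of the algebraic closure of `ℚ`, so their products over the grid
are rational; multiplied by suitable powers of the leading coefficients of the `Fᵢ` they are
integral, because by the Gauss lemma they are at most `1` at every valuation. Being nonzero
integers, they have absolute value at least `1`. No genericity of `F_x` is needed: the degree, the
multiplicities and even the vanishing of `F_x` may vary with `x`.
-/

noncomputable section

open Polynomial
open scoped Classical

namespace AmortizedBounds

/-! ### Products over grids of roots -/

/-- The set of tuples whose `i`-th entry belongs to the multiset `R i`. -/
def grid {ι K : Type*} [Fintype ι] (R : ι → Multiset K) : Finset (ι → K) :=
  Fintype.piFinset fun i => (R i).toFinset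

/-- The multiplicity of a tuple in the product of the multisets `R i`. -/
def gridCount {ι K : Type*} [Fintype ι] (R : ι → Multiset K) (x : ι → K) : ℕ :=
  ∏ i, (R i).count (x i)

/-- The number of tuples, with multiplicity, having a prescribed `i`-th entry from `R i`. -/
def cofactor {ι K : Type*} [Fintype ι] (R : ι → Multiset K) (i : ι) : ℕ :=
  ∏ j ∈ Finset.univ.erase i, (R j).card

section Grid

variable {ι K K' A : Type*} [Fintype ι]

lemma mem_grid {R : ι → Multiset K} {x : ι → K} : x ∈ grid R ↔ ∀ i, x i ∈ R i := by
  simp [grid]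

lemma sum_gridCount (R : ι → Multiset K) :
    ∑ x ∈ grid R, gridCount R x = ∏ i, (R i).card := by
  unfold grid gridCount
  rw [← Finset.prod_univ_sum (fun i => (R i).toFinset) fun i r => (R i).count r]
  simp

lemma sum_gridCount_fiber (R : ι → Multiset K) (i : ι) (r : K) (hr : r ∈ R i) :
    ∑ x ∈ grid R with x i = r, gridCount R x = (R i).count r * cofactor R i := by
  have h1 : (grid R).filter (fun x => x i = r)
      = Fintype.piFinset (Function.update (fun j => (R j).toFinset) i {r}) := by
    ext x
    simp only [Finset.mem_filter, mem_grid, Fintype.mem_piFinset]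
    constructor
    · rintro ⟨h, rfl⟩ j
      by_cases hj : j = i
      · subst hj; simp
      · simpa [hj] using h j
    · intro h
      have hi := h i
      simp only [Function.update_self, Finset.mem_singleton] at hi
      refine ⟨fun j => ?_, hi⟩
      by_cases hj : j = i
      · subst hj; rwa [hi]
      · simpa [hj] using h j
  rw [h1]
  unfold gridCount
  rw [← Finset.prod_univ_sum _ fun i r => (R i).count r,
    ← Finset.mul_prod_erase _ _ (Finset.mem_univ i)]
  congr 1
  · simp
  · refine Finset.prod_congr rfl fun j hj => ?_
    have := Finset.ne_of_mem_erase hj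
    simp [this]

lemma prod_grid_apply [CommMonoid A] (R : ι → Multiset K) (i : ι) (h : K → A) :
    ∏ x ∈ grid R, h (x i) ^ gridCount R x = ((R i).map h).prod ^ cofactor R i := by
  have hm : ∀ x ∈ grid R, x i ∈ (R i).toFinset := fun x hx => by
    simpa using mem_grid.1 hx i
  rw [← Finset.prod_fiberwise_of_maps_to hm, Finset.prod_multiset_map_count, ← Finset.prod_pow]
  refine Finset.prod_congr rfl fun r hr => ?_
  rw [← pow_mul, ← sum_gridCount_fiber R i r (by simpa using hr), ← Finset.prod_pow_eq_pow_sum]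
  refine Finset.prod_congr rfl fun x hx => ?_
  rw [(Finset.mem_filter.1 hx).2]

lemma sum_grid_apply (R : ι → Multiset K) (i : ι) (h : K → ℝ) :
    ∑ x ∈ grid R, (gridCount R x : ℝ) * h (x i) = cofactor R i * ((R i).map h).sum := by
  have := prod_grid_apply (A := Multiplicative ℝ) R i fun r => Multiplicative.ofAdd (h r)
  apply_fun Multiplicative.toAdd at this
  simp only [toAdd_prod, toAdd_pow, toAdd_ofAdd, nsmul_eq_mul] at this
  rw [this]
  congr 1

lemma prod_grid_prod [CommMonoid A] (R : ι → Multiset K) (h : K → A) :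
    ∏ x ∈ grid R, (∏ i, h (x i)) ^ gridCount R x = ∏ i, ((R i).map h).prod ^ cofactor R i := by
  simp_rw [← Finset.prod_pow]
  rw [Finset.prod_comm]
  exact Finset.prod_congr rfl fun i _ => prod_grid_apply R i h

lemma grid_map (R : ι → Multiset K) (ψ : K → K') :
    grid (fun i => (R i).map ψ) = (grid R).image (ψ ∘ ·) := by
  ext x
  simp only [mem_grid, Finset.mem_image, Multiset.mem_map]
  constructor
  · intro h
    choose y hy using h
    exact ⟨y, fun i => (hy i).1, funext fun i => (hy i).2⟩
  · rintro ⟨y, hy, rfl⟩ i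
    exact ⟨y i, hy i, rfl⟩

lemma gridCount_map (R : ι → Multiset K) {ψ : K → K'} (hψ : Function.Injective ψ) (x : ι → K) :
    gridCount (fun i => (R i).map ψ) (ψ ∘ x) = gridCount R x :=
  Finset.prod_congr rfl fun i _ => by simp [Multiset.count_map_eq_count' _ _ hψ]

lemma prod_grid_map [CommMonoid A] (R : ι → Multiset K) {ψ : K → K'}
    (hψ : Function.Injective ψ) (G : (ι → K') → A) :
    ∏ x ∈ grid (fun i => (R i).map ψ), G x ^ gridCount (fun i => (R i).map ψ) x
      = ∏ x ∈ grid R, G (ψ ∘ x) ^ gridCount R x := by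
  rw [grid_map, Finset.prod_image (hψ.comp_left.injOn)]
  simp only [gridCount_map R hψ]

lemma cofactor_map (R : ι → Multiset K) (ψ : K → K') (i : ι) :
    cofactor (fun i => (R i).map ψ) i = cofactor R i := by
  simp [cofactor]

end Grid

/-! ### Valuations of polynomials -/

section Valuation

variable {K Γ : Type*} [Field K] [LinearOrderedCommGroupWithZero Γ] (v : Valuation K Γ)

lemma valuation_natCast_le_one (m : ℕ) : v (m : K) ≤ 1 := by
  induction m with
  | zero => simp
  | succ m ih =>
    rw [Nat.cast_succ]
    exact v.map_add_le ih (by simp)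

lemma valuation_intCast_le_one (m : ℤ) : v (m : K) ≤ 1 := by
  obtain ⟨k, rfl | rfl⟩ := m.eq_nat_or_neg
  · simpa using valuation_natCast_le_one v k
  · simpa [Valuation.map_neg] using valuation_natCast_le_one v k

/-- The Gauss lemma for a linear factor. If `v y ≤ 1` the coefficients of `g` are recovered from
those of `(X - y) g` from the top down, and otherwise from the bottom up. -/
lemma valuation_coeff_mul_max_le (y : K) (g : K[X]) {B : Γ}
    (h : ∀ k, v (((X - C y) * g).coeff k) ≤ B) (k : ℕ) : v (g.coeff k) * max 1 (v y) ≤ B := by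
  have hs (k : ℕ) : ((X - C y) * g).coeff (k + 1) = g.coeff k - y * g.coeff (k + 1) := by
    simp [sub_mul]
  rcases le_total (v y) 1 with hy | hy
  · rw [max_eq_left hy, mul_one]
    have key : ∀ j k, g.natDegree < k + j → v (g.coeff k) ≤ B := by
      intro j
      induction j with
      | zero =>
        intro k hk
        rw [coeff_eq_zero_of_natDegree_lt (by simpa using hk), map_zero]
        exact zero_le
      | succ j ih =>
        intro k hk
        have e : g.coeff k = ((X - C y) * g).coeff (k + 1) + y * g.coeff (k + 1) := by
          rw [hs]; ring
        rw [e]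
        refine v.map_add_le (h _) ?_
        rw [map_mul]
        exact (mul_le_of_le_one_left' hy).trans (ih (k + 1) (by omega))
    exact key (g.natDegree + 1) k (by omega)
  · rw [max_eq_right hy]
    induction k with
    | zero =>
      have := h 0
      rw [mul_coeff_zero] at this
      simpa [mul_comm, Valuation.map_neg] using this
    | succ k ih =>
      have e : g.coeff (k + 1) * y = g.coeff k - ((X - C y) * g).coeff (k + 1) := by
        rw [hs]; ring
      rw [← map_mul, e]
      refine v.map_sub_le ?_ (h _)
      exact (le_mul_of_one_le_right' hy).trans ih

lemma valuation_coeff_mul_prod_max_le (s : Multiset K) (g : K[X]) {B : Γ}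
    (h : ∀ k, v (((s.map fun y => X - C y).prod * g).coeff k) ≤ B) (k : ℕ) :
    v (g.coeff k) * (s.map fun y => max 1 (v y)).prod ≤ B := by
  induction s using Multiset.induction generalizing B with
  | empty => simpa using h k
  | cons a s ih =>
    have hpos : 0 < max 1 (v a) := lt_of_lt_of_le zero_lt_one (le_max_left _ _)
    have h' : ∀ k, v (((s.map fun y => X - C y).prod * g).coeff k) ≤ B * (max 1 (v a))⁻¹ := by
      intro k
      rw [← mul_inv_le_iff₀ (inv_pos.2 hpos), inv_inv]
      refine valuation_coeff_mul_max_le v a _ (fun k => ?_) k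
      simpa [mul_assoc] using h k
    have := ih h'
    rw [← mul_inv_le_iff₀ (inv_pos.2 hpos), inv_inv] at this
    rw [Multiset.map_cons, Multiset.prod_cons]
    calc _ = _ := by ac_rfl
      _ ≤ B := this

/-- The Gauss lemma: `v c ∏ max 1 (v y) ≤ B` whenever `v` is at most `B` on the coefficients of
`c ∏ (X - y)`. -/
lemma valuation_leadingCoeff_mul_prod_max_le {f : K[X]} (hf : f.Splits) {B : Γ}
    (h : ∀ k, v (f.coeff k) ≤ B) :
    v f.leadingCoeff * (f.roots.map fun y => max 1 (v y)).prod ≤ B := by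
  have := valuation_coeff_mul_prod_max_le v f.roots (C f.leadingCoeff) (B := B) (fun k => by
    rw [mul_comm, ← hf.eq_prod_roots]; exact h k) 0
  simpa using this

lemma valuation_eval_le {f : K[X]} {B : Γ} (h : ∀ k, v (f.coeff k) ≤ B) {δ : ℕ}
    (hδ : f.natDegree ≤ δ) (y : K) : v (f.eval y) ≤ B * max 1 (v y) ^ δ := by
  rw [eval_eq_sum_range]
  refine v.map_sum_le fun i hi => ?_
  rw [map_mul, map_pow]
  refine mul_le_mul' (h i) ?_
  calc v y ^ i ≤ max 1 (v y) ^ i := pow_le_pow_left' (le_max_right _ _) i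
    _ ≤ max 1 (v y) ^ δ := pow_le_pow_right' (le_max_left _ _)
        (by have := Finset.mem_range.1 hi; omega)

lemma valuation_hasseDeriv_coeff_le {f : K[X]} {B : Γ} (h : ∀ k, v (f.coeff k) ≤ B) (μ k : ℕ) :
    v ((hasseDeriv μ f).coeff k) ≤ B := by
  rw [hasseDeriv_coeff, map_mul]
  exact (mul_le_of_le_one_left' (valuation_natCast_le_one v _)).trans (h _)

end Valuation

/-! ### The generalized discriminant -/

section GDisc

variable {K K' : Type*} [Field K] [Field K']

/-- The value at `y` of the first Hasse derivative of `f` that does not vanish there. -/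
def localDeriv (f : K[X]) (y : K) : K := (hasseDeriv (f.rootMultiplicity y) f).eval y

/-- The product of the values `localDeriv f y` over the roots `y` of `f`, with multiplicity.
It is never zero, and equals `1` for `f = 0`. -/
def gdisc (f : K[X]) : K := (f.roots.map (localDeriv f)).prod

lemma localDeriv_map (ψ : K →+* K') (f : K[X]) (y : K) :
    localDeriv (f.map ψ) (ψ y) = ψ (localDeriv f y) := by
  unfold localDeriv
  rw [← eq_rootMultiplicity_map ψ.injective]
  have : hasseDeriv (f.rootMultiplicity y) (f.map ψ) =
      (hasseDeriv (f.rootMultiplicity y) f).map ψ := by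
    ext; simp [hasseDeriv_coeff]
  rw [this, eval_map_apply]

lemma gdisc_map [IsAlgClosed K] (ψ : K →+* K') (f : K[X]) : gdisc (f.map ψ) = ψ (gdisc f) := by
  unfold gdisc
  rw [(IsAlgClosed.splits f).roots_map, Multiset.map_map, map_multiset_prod, Multiset.map_map]
  congr 1
  exact Multiset.map_congr rfl fun y _ => localDeriv_map ψ f y

/-- The value is read off the Taylor expansion at `y`. -/
lemma localDeriv_eq_eval {f g : K[X]} {y : K} (h : f = (X - C y) ^ f.rootMultiplicity y * g) :
    localDeriv f y = g.eval y := by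
  unfold localDeriv
  rw [← taylor_coeff, congrArg (taylor y) h, taylor_mul, taylor_pow]
  simp [coeff_X_pow_mul']

lemma localDeriv_ne_zero {f : K[X]} (hf : f ≠ 0) (y : K) : localDeriv f y ≠ 0 := by
  rw [localDeriv_eq_eval (pow_mul_divByMonic_rootMultiplicity_eq f y).symm]
  exact eval_divByMonic_pow_rootMultiplicity_ne_zero y hf

lemma gdisc_ne_zero (f : K[X]) : gdisc f ≠ 0 := by
  unfold gdisc
  refine Multiset.prod_ne_zero fun h => ?_
  obtain ⟨y, hy, h0⟩ := Multiset.mem_map.1 h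
  exact localDeriv_ne_zero (ne_zero_of_mem_roots hy) y h0

/-- Each factor of `gdisc f` at a root `y` is at most `B max 1 (v y) ^ deg f`, and the Gauss lemma
shows that the powers of the leading coefficient compensate for the product of the maxima. -/
lemma valuation_gdisc_le [IsAlgClosed K] {Γ : Type*} [LinearOrderedCommGroupWithZero Γ]
    (v : Valuation K Γ) {f : K[X]} {B : Γ} (h : ∀ k, v (f.coeff k) ≤ B) :
    v (f.leadingCoeff ^ f.natDegree * gdisc f) ≤ B ^ (2 * f.natDegree) := by
  have h1 : v (gdisc f) ≤
      B ^ f.natDegree * (f.roots.map fun y => max 1 (v y)).prod ^ f.natDegree := by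
    unfold gdisc
    rw [map_multiset_prod, Multiset.map_map]
    calc _ ≤ (f.roots.map fun y => B * max 1 (v y) ^ f.natDegree).prod := by
          refine Multiset.prod_map_le_prod_map _ _ fun y _ => ?_
          exact valuation_eval_le v (valuation_hasseDeriv_coeff_le v h _)
            ((natDegree_hasseDeriv_le _ _).trans (Nat.sub_le _ _)) y
      _ = _ := by
          rw [Multiset.prod_map_mul, Multiset.prod_map_pow, Multiset.map_const',
            Multiset.prod_replicate, splits_iff_card_roots.1 (IsAlgClosed.splits f)]
  rw [map_mul, map_pow]
  calc _ ≤ v f.leadingCoeff ^ f.natDegree * _ := mul_le_mul_right h1 _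
    _ = B ^ f.natDegree *
        (v f.leadingCoeff * (f.roots.map fun y => max 1 (v y)).prod) ^ f.natDegree := by
        rw [mul_pow, mul_left_comm]
    _ ≤ B ^ f.natDegree * B ^ f.natDegree := mul_le_mul_right (pow_le_pow_left'
        (valuation_leadingCoeff_mul_prod_max_le v (IsAlgClosed.splits f) h) _) _
    _ = _ := by rw [← pow_add, two_mul]

end GDisc

/-! ### Specialization -/

section Specialize

variable {n : ℕ} {K K' : Type*} [Field K] [Field K']

/-- The roots in `K` of the polynomials `Fs i`, with multiplicity. -/
def rootsIn (K : Type*) [Field K] (Fs : Fin n → ℤ[X]) (i : Fin n) : Multiset K :=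
  ((Fs i).map (Int.castRingHom K)).roots

/-- The polynomial `F(x, Y)`, for a point `x` with coordinates in any field. -/
def specializeAt (F : MvPolynomial (Option (Fin n)) ℤ) (x : Fin n → K) : K[X] :=
  MvPolynomial.aeval (fun o : Option (Fin n) => o.elim X fun i => C (x i)) F

lemma rootsIn_map [IsAlgClosed K] (ψ : K →+* K') (Fs : Fin n → ℤ[X]) (i : Fin n) :
    rootsIn K' Fs i = (rootsIn K Fs i).map ψ := by
  unfold rootsIn
  rw [← (IsAlgClosed.splits _).roots_map, Polynomial.map_map]
  congr 2
  exact RingHom.ext_int _ _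

lemma card_rootsIn [IsAlgClosed K] [CharZero K] (Fs : Fin n → ℤ[X]) (i : Fin n) :
    (rootsIn K Fs i).card = (Fs i).natDegree := by
  unfold rootsIn
  rw [splits_iff_card_roots.1 (IsAlgClosed.splits _),
    natDegree_map_eq_of_injective (RingHom.injective_int _)]

lemma specializeAt_map (F : MvPolynomial (Option (Fin n)) ℤ) (ψ : K →+* K') (x : Fin n → K) :
    specializeAt F (ψ ∘ x) = (specializeAt F x).map ψ := by
  have : (MvPolynomial.aeval (R := ℤ)
        (fun o : Option (Fin n) => o.elim (X : K'[X]) fun i => C ((ψ ∘ x) i))).toRingHom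
      = (mapRingHom ψ).comp (MvPolynomial.aeval (R := ℤ)
        (fun o : Option (Fin n) => o.elim X fun i => C (x i))).toRingHom := by
    refine MvPolynomial.ringHom_ext (fun r => by simp) fun o => ?_
    cases o <;> simp
  exact congrArg (fun f => f F) this

lemma specializeAt_eq_sum (F : MvPolynomial (Option (Fin n)) ℤ) (x : Fin n → K) :
    specializeAt F x = ∑ m ∈ F.support,
      C (((F.coeff m : ℤ) : K) * ∏ i, x i ^ m (some i)) * X ^ m none := by
  unfold specializeAt
  rw [MvPolynomial.aeval_def, MvPolynomial.eval₂_eq']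
  refine Finset.sum_congr rfl fun m _ => ?_
  rw [Fintype.prod_option]
  simp only [Option.elim, map_mul, map_prod, map_pow, eq_intCast, map_intCast]
  ring

lemma coeff_specializeAt (F : MvPolynomial (Option (Fin n)) ℤ) (x : Fin n → K) (k : ℕ) :
    (specializeAt F x).coeff k = ∑ m ∈ F.support,
      if k = m none then ((F.coeff m : ℤ) : K) * ∏ i, x i ^ m (some i) else 0 := by
  rw [specializeAt_eq_sum, finsetSum_coeff]
  exact Finset.sum_congr rfl fun m _ => by rw [coeff_C_mul_X_pow]

lemma le_totalDegree_of_mem_support {F : MvPolynomial (Option (Fin n)) ℤ}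
    {m : Option (Fin n) →₀ ℕ} (hm : m ∈ F.support) : m none + ∑ i, m (some i) ≤ F.totalDegree := by
  have := MvPolynomial.le_totalDegree hm
  rwa [Finsupp.sum_fintype _ _ fun _ => rfl, Fintype.sum_option] at this

lemma natDegree_specializeAt_le (F : MvPolynomial (Option (Fin n)) ℤ) (x : Fin n → K) :
    (specializeAt F x).natDegree ≤ F.totalDegree := by
  rw [specializeAt_eq_sum]
  refine natDegree_sum_le_of_forall_le _ _ fun m hm => (natDegree_C_mul_X_pow_le _ _).trans ?_
  have := le_totalDegree_of_mem_support hm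
  omega

lemma valuation_coeff_specializeAt_le {Γ : Type*} [LinearOrderedCommGroupWithZero Γ]
    (v : Valuation K Γ) (F : MvPolynomial (Option (Fin n)) ℤ) (x : Fin n → K) (k : ℕ) :
    v ((specializeAt F x).coeff k) ≤ (∏ i, max 1 (v (x i))) ^ F.totalDegree := by
  rw [coeff_specializeAt]
  refine v.map_sum_le fun m hm => ?_
  split_ifs
  · rw [map_mul, map_prod, ← one_mul ((∏ i, max 1 (v (x i))) ^ F.totalDegree), ← Finset.prod_pow]
    refine mul_le_mul' (valuation_intCast_le_one v _) (Finset.prod_le_prod' fun i _ => ?_)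
    rw [map_pow]
    refine (pow_le_pow_left' (le_max_right 1 _) _).trans (pow_le_pow_right' (le_max_left _ _) ?_)
    have h1 := le_totalDegree_of_mem_support hm
    have h2 := Finset.single_le_sum (f := fun i => m (some i)) (fun _ _ => Nat.zero_le _)
      (Finset.mem_univ i)
    omega
  · simp

end Specialize

/-! ### Integrality of products over the grid -/

section Integrality

variable {n : ℕ} {L : Type*} [Field L]

lemma isIntegral_of_forall_valuation_le_one {z : L}
    (h : ∀ V : ValuationSubring L, V.valuation z ≤ 1) : IsIntegral ℤ z := by
  have hz : z ∈ (⨅ V : {V : ValuationSubring L // (∅ : Set L) ⊆ V.toSubring}, V.1.toSubring) := by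
    rw [Subring.mem_iInf]
    exact fun V => (V.1.valuation_le_one_iff z).1 (h V.1)
  rw [iInf_valuationSubring_superset, Subring.closure_empty] at hz
  have hz' : IsIntegral (⊥ : Subring L) z := hz
  have : Algebra.IsIntegral ℤ (⊥ : Subring L) := by
    refine ⟨fun y => ?_⟩
    obtain ⟨m, hm⟩ := Subring.mem_bot.1 y.2
    have : y = algebraMap ℤ (⊥ : Subring L) m := Subtype.ext (by simp [← hm])
    rw [this]
    exact isIntegral_algebraMap
  exact isIntegral_trans z hz'

/-- A product over the grid of values `g x` that are permuted by the Galois group, multiplied by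
enough leading coefficients of the `Fs i` to make it integral, is a nonzero rational integer, so
its absolute value is at least `1`. -/
lemma sum_log_norm_grid_ge [CharZero L] [IsAlgClosed L] [Algebra ℚ L] [IsGalois ℚ L]
    (φ : L →+* ℂ) (Fs : Fin n → ℤ[X]) (hFs : ∀ i, Fs i ≠ 0) (E : ℕ) (g : (Fin n → L) → L)
    (hg : ∀ x, g x ≠ 0) (hgal : ∀ (σ : Gal(L/ℚ)) (x : Fin n → L), g (σ ∘ x) = σ (g x))
    (hval : ∀ (V : ValuationSubring L) (x : Fin n → L),
      V.valuation (g x) ≤ (∏ i, max 1 (V.valuation (x i))) ^ E) :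
    -(∑ i, (E * cofactor (rootsIn L Fs) i : ℕ) * Real.log |((Fs i).leadingCoeff : ℝ)|) ≤
      ∑ x ∈ grid (rootsIn L Fs), (gridCount (rootsIn L Fs) x : ℝ) * Real.log ‖φ (g x)‖ := by
  set R := rootsIn L Fs with hR
  set P : L := (∏ i, ((Fs i).leadingCoeff : L) ^ (E * cofactor R i)) *
    ∏ x ∈ grid R, g x ^ gridCount R x with hP
  have hlc : ∀ i, ((Fs i).leadingCoeff : ℤ) ≠ 0 := fun i => leadingCoeff_ne_zero.2 (hFs i)
  have hP0 : P ≠ 0 := mul_ne_zero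
    (Finset.prod_ne_zero_iff.2 fun i _ => pow_ne_zero _ (Int.cast_ne_zero.2 (hlc i)))
    (Finset.prod_ne_zero_iff.2 fun x _ => pow_ne_zero _ (hg x))
  have hfix : ∀ σ : Gal(L/ℚ), σ P = P := by
    intro σ
    have hRσ : (fun i => (R i).map σ) = R := by
      funext i
      exact (rootsIn_map (σ : L →+* L) Fs i).symm
    have := prod_grid_map R (ψ := σ) σ.injective g
    rw [hRσ] at this
    rw [hP, map_mul, map_prod, map_prod, this]
    simp only [map_pow, map_intCast, hgal]
  obtain ⟨q, hq⟩ := IntermediateField.mem_bot.1 ((InfiniteGalois.mem_bot_iff_fixed P).2 hfix)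
  have hint : IsIntegral ℤ P := by
    refine isIntegral_of_forall_valuation_le_one fun V => ?_
    have h1 : ∏ x ∈ grid R, V.valuation (g x) ^ gridCount R x ≤
        ∏ i, (((R i).map fun y => max 1 (V.valuation y)).prod ^ E) ^ cofactor R i := by
      calc _ ≤ ∏ x ∈ grid R, (∏ i, max 1 (V.valuation (x i)) ^ E) ^ gridCount R x := by
            refine Finset.prod_le_prod' fun x _ => pow_le_pow_left' ?_ _
            rw [Finset.prod_pow]
            exact hval V x
        _ = _ := by
            rw [prod_grid_prod R fun y => max 1 (V.valuation y) ^ E]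
            simp only [Multiset.prod_map_pow]
    have h2 : ∀ i, V.valuation ((Fs i).leadingCoeff : L) *
        ((R i).map fun y => max 1 (V.valuation y)).prod ≤ 1 := by
      intro i
      have := valuation_leadingCoeff_mul_prod_max_le V.valuation (B := 1)
        (IsAlgClosed.splits ((Fs i).map (Int.castRingHom L)))
        fun k => by simp [valuation_intCast_le_one]
      rwa [leadingCoeff_map_of_injective (RingHom.injective_int _)] at this
    rw [hP, map_mul, map_prod, map_prod]
    simp only [map_pow]
    calc _ ≤ (∏ i, V.valuation ((Fs i).leadingCoeff : L) ^ (E * cofactor R i)) *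
          ∏ i, (((R i).map fun y => max 1 (V.valuation y)).prod ^ E) ^ cofactor R i :=
            mul_le_mul_right h1 _
      _ = ∏ i, (V.valuation ((Fs i).leadingCoeff : L) *
          ((R i).map fun y => max 1 (V.valuation y)).prod) ^ (E * cofactor R i) := by
            rw [← Finset.prod_mul_distrib]
            exact Finset.prod_congr rfl fun i _ => by rw [mul_pow, pow_mul, pow_mul]
      _ ≤ 1 := Finset.prod_le_one' fun i _ => pow_le_one' (h2 i) _
  have hintq : IsIntegral ℤ q := by
    rw [← hq] at hint
    exact (isIntegral_algebraMap_iff (algebraMap ℚ L).injective).1 hint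
  obtain ⟨m, hm⟩ := IsIntegrallyClosed.isIntegral_iff.1 hintq
  have hPm : P = (m : L) := by rw [← hq, ← hm]; simp
  have hm0 : m ≠ 0 := by rintro rfl; exact hP0 (by simpa using hPm)
  -- A nonzero integer has absolute value at least one; the logarithm turns this into the claim.
  have hnorm : 1 ≤ ‖φ P‖ := by
    rw [hPm, map_intCast, Complex.norm_intCast]
    exact_mod_cast Int.one_le_abs hm0
  have hlog := Real.log_nonneg hnorm
  rw [hP, map_mul, map_prod, map_prod, norm_mul, norm_prod, norm_prod, Real.log_mul, Real.log_prod,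
    Real.log_prod] at hlog
  · simp only [map_pow, norm_pow, Real.log_pow, map_intCast, Complex.norm_intCast] at hlog
    linarith
  · exact fun x _ => by simp [hg x]
  · exact fun i _ => by simp [hFs i]
  · exact Finset.prod_ne_zero_iff.2 fun i _ => by simp [hFs i]
  · exact Finset.prod_ne_zero_iff.2 fun x _ => by simp [hg x]

end Integrality

/-- The Galois-theoretic lower bound over `ℂ`, for a function of the specialization `F(x, Y)` that
is defined over every field and compatible with homomorphisms. -/
lemma sum_log_norm_specialize_ge {n : ℕ} (Fs : Fin n → ℤ[X]) (hFs : ∀ i, Fs i ≠ 0)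
    (F : MvPolynomial (Option (Fin n)) ℤ) (E : ℕ)
    (g : ∀ (K : Type) [Field K], K[X] → K)
    (hg : ∀ (K : Type) [Field K] (f : K[X]), g K f ≠ 0)
    (hmap : ∀ (K K' : Type) [Field K] [IsAlgClosed K] [Field K'] (ψ : K →+* K') (f : K[X]),
      g K' (f.map ψ) = ψ (g K f))
    (hval : ∀ (K : Type) [Field K] [IsAlgClosed K] (V : ValuationSubring K) (x : Fin n → K),
      V.valuation (g K (specializeAt F x)) ≤ (∏ i, max 1 (V.valuation (x i))) ^ E) :
    -(∑ i, (E * cofactor (rootsIn ℂ Fs) i : ℕ) * Real.log |((Fs i).leadingCoeff : ℝ)|) ≤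
      ∑ x ∈ grid (rootsIn ℂ Fs), (gridCount (rootsIn ℂ Fs) x : ℝ) *
        Real.log ‖g ℂ (specializeAt F x)‖ := by
  let L := algebraicClosure ℚ ℂ
  -- The `ℚ`-algebra structure as an intermediate field, the one known to be an algebraic closure.
  let _ : Algebra ℚ L := (algebraicClosure ℚ ℂ).algebra'
  have hL : IsAlgClosure ℚ L := algebraicClosure.isAlgClosure ℚ ℂ
  have : IsAlgClosed L := IsAlgClosure.isAlgClosed ℚ
  have : IsGalois ℚ L := IsAlgClosure.isGalois ℚ L
  let φ : L →+* ℂ := algebraMap L ℂ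
  have hR : rootsIn ℂ Fs = fun i => (rootsIn L Fs i).map φ := funext fun i => rootsIn_map φ Fs i
  have h := sum_log_norm_grid_ge φ Fs hFs E (fun x => g L (specializeAt F x)) (fun x => hg L _)
    (fun σ x => by
      have := specializeAt_map F (σ : L →+* L) x
      exact (congrArg (g L) this).trans (hmap L L (σ : L →+* L) _)) (hval L)
  have hsum := prod_grid_map (A := Multiplicative ℝ) (rootsIn L Fs) φ.injective
    fun x => Multiplicative.ofAdd (Real.log ‖g ℂ (specializeAt F x)‖)
  rw [← hR] at hsum
  apply_fun Multiplicative.toAdd at hsum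
  simp only [toAdd_prod, toAdd_pow, toAdd_ofAdd, nsmul_eq_mul, specializeAt_map, hmap] at hsum
  rw [hsum]
  have hc : ∀ i, cofactor (rootsIn ℂ Fs) i = cofactor (rootsIn L Fs) i := fun i => by
    rw [hR, cofactor_map]
  simpa only [hc] using h

/-! ### Logarithmic estimates for a complex polynomial -/

open Real in
lemma abs_log_eq (x : ℝ) : |log x| = 2 * log⁺ x - log x := by
  rw [← half_mul_log_add_log_abs]; ring

open Real in
lemma log_norm_sub_le (y z : ℂ) : log ‖y - z‖ ≤ log 2 + log⁺ ‖y‖ + log⁺ ‖z‖ := by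
  have h := posLog_norm_add_le y (-z)
  rw [norm_neg, ← sub_eq_add_neg] at h
  have h' : log ‖y - z‖ ≤ log⁺ ‖y - z‖ := le_max_right 0 _
  linarith

open Real in
lemma log_norm_prod_map {s : Multiset ℂ} {h : ℂ → ℂ} (hs : ∀ y ∈ s, h y ≠ 0) :
    log ‖(s.map h).prod‖ = (s.map fun y => log ‖h y‖).sum := by
  induction s using Multiset.induction with
  | empty => simp
  | cons a s ih =>
    have hs' : ∀ y ∈ s, h y ≠ 0 := fun y hy => hs y (Multiset.mem_cons_of_mem hy)
    rw [Multiset.map_cons, Multiset.prod_cons, Multiset.map_cons, Multiset.sum_cons, norm_mul,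
      log_mul, ih hs']
    · exact norm_ne_zero_iff.2 (hs a (Multiset.mem_cons_self a s))
    · refine norm_ne_zero_iff.2 (Multiset.prod_ne_zero fun h0 => ?_)
      obtain ⟨y, hy, hy0⟩ := Multiset.mem_map.1 h0
      exact hs' y hy hy0

/-- The nonnegative part of the natural logarithm of the `ℓ¹` norm of the coefficients of `f`. -/
def logSize (f : ℂ[X]) : ℝ := Real.posLog (f.sum fun _ a => ‖a‖)

section Univariate

open Real

variable (f : ℂ[X])

lemma logSize_nonneg : 0 ≤ logSize f := posLog_nonneg

lemma log_leadingCoeff_add_sum_le_logSize :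
    log ‖f.leadingCoeff‖ + (f.roots.map fun y => log⁺ ‖y‖).sum ≤ logSize f := by
  rw [← logMahlerMeasure_eq_log_leadingCoeff_add_sum_log_roots,
    logMahlerMeasure_eq_log_MahlerMeasure]
  by_cases hf : f = 0
  · simp [hf, logSize_nonneg]
  · exact (log_le_log (mahlerMeasure_pos_of_ne_zero hf) (mahlerMeasure_le_sum_norm_coeff f)).trans
      (le_max_right _ _)

lemma sum_posLog_nonneg (s : Multiset ℂ) : 0 ≤ (s.map fun y => log⁺ ‖y‖).sum :=
  Multiset.sum_nonneg fun t ht => by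
    obtain ⟨y, _, rfl⟩ := Multiset.mem_map.1 ht
    exact posLog_nonneg

lemma log_leadingCoeff_le_logSize : log ‖f.leadingCoeff‖ ≤ logSize f := by
  have := log_leadingCoeff_add_sum_le_logSize f
  have := sum_posLog_nonneg f.roots
  linarith

lemma posLog_norm_le_of_mem_roots {y : ℂ} (hy : y ∈ f.roots) :
    log⁺ ‖y‖ ≤ logSize f - log ‖f.leadingCoeff‖ := by
  have h1 := log_leadingCoeff_add_sum_le_logSize f
  rw [← Multiset.cons_erase hy, Multiset.map_cons, Multiset.sum_cons] at h1
  have := sum_posLog_nonneg (f.roots.erase y)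
  linarith

/-- A Hasse derivative multiplies the coefficients by binomial coefficients, which are at most
`2 ^ deg f`. -/
lemma posLog_localDeriv_le (y : ℂ) :
    log⁺ ‖localDeriv f y‖ ≤ f.natDegree * log 2 + logSize f + f.natDegree * log⁺ ‖y‖ := by
  have h : ‖localDeriv f y‖ ≤
      2 ^ f.natDegree * (f.sum fun _ a => ‖a‖) * max 1 ‖y‖ ^ f.natDegree := by
    unfold localDeriv
    rw [hasseDeriv_apply, sum_def, sum_def, eval_finsetSum, Finset.mul_sum, Finset.sum_mul]
    refine (norm_sum_le _ _).trans (Finset.sum_le_sum fun i hi => ?_)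
    have hi' := le_natDegree_of_mem_supp i hi
    rw [eval_monomial, norm_mul, norm_mul, norm_pow, Complex.norm_natCast]
    have h1 : ((i.choose (f.rootMultiplicity y) : ℕ) : ℝ) ≤ 2 ^ f.natDegree := by
      have : i.choose (f.rootMultiplicity y) ≤ 2 ^ f.natDegree :=
        (Nat.choose_le_two_pow _ _).trans (Nat.pow_le_pow_right (by norm_num) hi')
      exact_mod_cast this
    have h2 : ‖y‖ ^ (i - f.rootMultiplicity y) ≤ max 1 ‖y‖ ^ f.natDegree :=
      (pow_le_pow_left₀ (norm_nonneg _) (le_max_right 1 _) _).trans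
        (pow_le_pow_right₀ (le_max_left _ _) ((Nat.sub_le _ _).trans hi'))
    gcongr
  refine (posLog_le_posLog (norm_nonneg _) h).trans (posLog_mul.trans ?_)
  refine add_le_add (posLog_mul.trans (add_le_add ?_ le_rfl)) ?_
  · rw [posLog_pow, posLog_eq_log (by norm_num)]
  · rw [posLog_pow, posLog_eq_log ((le_max_left 1 ‖y‖).trans (le_abs_self _)),
      posLog_eq_log_max_one (norm_nonneg y)]

lemma sum_log_localDeriv :
    (f.roots.map fun y => log ‖localDeriv f y‖).sum = log ‖gdisc f‖ := by
  rw [gdisc, log_norm_prod_map fun y hy => localDeriv_ne_zero (ne_zero_of_mem_roots hy) y]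

lemma card_roots_complex : f.roots.card = f.natDegree :=
  splits_iff_card_roots.1 (IsAlgClosed.splits f)

lemma sum_roots_const (c : ℝ) : (f.roots.map fun _ => c).sum = f.natDegree * c := by
  rw [Multiset.map_const', Multiset.sum_replicate, card_roots_complex, nsmul_eq_mul]

/-- A sum over the distinct roots, weighted by multiplicity, as a sum over the multiset of roots. -/
lemma sum_toFinset_rootMultiplicity (h : ℂ → ℝ) :
    ∑ y ∈ f.roots.toFinset, (f.rootMultiplicity y : ℝ) * |logb 2 (h y)| =
      (f.roots.map fun y => |log (h y)|).sum / log 2 := by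
  rw [Finset.sum_multiset_map_count, Finset.sum_div]
  refine Finset.sum_congr (by congr!) fun y _ => ?_
  rw [count_roots, nsmul_eq_mul, logb, abs_div, abs_of_pos (log_pos one_lt_two), mul_div_assoc]

/-- The coefficients are chosen so that `lGDisc` and `lsep` satisfy the same bound. -/
lemma lGDisc_le : lGDisc f * log 2 ≤ 3 * f.natDegree ^ 2 * log 2 + 7 * (f.natDegree * logSize f)
    - 4 * log ‖f.leadingCoeff ^ f.natDegree‖
    - log ‖f.leadingCoeff ^ f.natDegree * gdisc f‖ := by
  by_cases hf : f = 0
  · simp [hf, lGDisc, gdisc]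
  have hlc : f.leadingCoeff ≠ 0 := leadingCoeff_ne_zero.2 hf
  have h1 : lGDisc f * log 2 = (f.roots.map fun y => |log ‖localDeriv f y‖|).sum := by
    have := sum_toFinset_rootMultiplicity f fun y => ‖localDeriv f y‖
    rw [eq_div_iff (log_pos one_lt_two).ne'] at this
    rw [← this]
    unfold lGDisc localDeriv
    congr!
  have h2 : (f.roots.map fun y => |log ‖localDeriv f y‖|).sum ≤
      (f.roots.map fun y => (2 * (f.natDegree * log 2 + logSize f) +
        2 * f.natDegree * log⁺ ‖y‖) + -log ‖localDeriv f y‖).sum := by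
    refine Multiset.sum_map_le_sum_map _ _ fun y _ => ?_
    rw [abs_log_eq]
    have := posLog_localDeriv_le f y
    linarith
  rw [Multiset.sum_map_add, Multiset.sum_map_add, sum_roots_const, Multiset.sum_map_mul_left,
    Multiset.sum_map_neg, sum_log_localDeriv] at h2
  rw [h1, norm_mul, log_mul (by simp [hlc]) (by simp [gdisc_ne_zero]), norm_pow, log_pow]
  have h3 := mul_le_mul_of_nonneg_left (log_leadingCoeff_add_sum_le_logSize f)
    (Nat.cast_nonneg (α := ℝ) f.natDegree)
  have h4 := mul_le_mul_of_nonneg_left (log_leadingCoeff_le_logSize f)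
    (Nat.cast_nonneg (α := ℝ) f.natDegree)
  have h5 : 0 ≤ (f.natDegree : ℝ) ^ 2 * log 2 := by positivity
  linarith

lemma sep_eq_zero_of_filter_eq_zero {y : ℂ} (h : f.roots.filter (· ≠ y) = 0) (hf : f ≠ 0) :
    sep y f = 0 := by
  have : {z : ℂ | f.IsRoot z ∧ z ≠ y} = ∅ := by
    ext z
    simp only [Set.mem_ofPred_eq, Set.mem_empty_iff_false, iff_false]
    intro hz
    have : z ∈ f.roots.filter (· ≠ y) := Multiset.mem_filter.2 ⟨(mem_roots hf).2 hz.1, hz.2⟩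
    simp [h] at this
  rw [sep, this]
  simp

/-- If there is a root other than `y`, then the separation is attained. -/
lemma exists_sep_eq {y : ℂ} (hf : f ≠ 0) (h : f.roots.filter (· ≠ y) ≠ 0) :
    ∃ z ∈ f.roots.filter (· ≠ y), sep y f = ‖y - z‖ := by
  obtain ⟨w, hw⟩ := Multiset.exists_mem_of_ne_zero h
  have hw' := Multiset.mem_filter.1 hw
  have hfin : ((fun z : ℂ => ‖z - y‖) '' {z : ℂ | f.IsRoot z ∧ z ≠ y}).Finite :=
    ((finite_setOfPred_isRoot hf).subset fun z hz => hz.1).image _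
  have hne : ((fun z : ℂ => ‖z - y‖) '' {z : ℂ | f.IsRoot z ∧ z ≠ y}).Nonempty :=
    ⟨_, w, ⟨(mem_roots hf).1 hw'.1, hw'.2⟩, rfl⟩
  obtain ⟨z, hz, hzs⟩ := hne.csInf_mem hfin
  exact ⟨z, Multiset.mem_filter.2 ⟨(mem_roots hf).2 hz.1, hz.2⟩, by
    rw [norm_sub_rev]; exact hzs.symm⟩

lemma localDeriv_eq_prod (y : ℂ) : localDeriv f y =
    f.leadingCoeff * ((f.roots.filter (· ≠ y)).map fun z => y - z).prod := by
  have h : f = (X - C y) ^ f.rootMultiplicity y *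
      (C f.leadingCoeff * ((f.roots.filter (· ≠ y)).map fun z => X - C z).prod) := by
    conv_lhs => rw [(IsAlgClosed.splits f).eq_prod_roots, ← Multiset.filter_add_not (· = y) f.roots]
    rw [Multiset.map_add, Multiset.prod_add, Multiset.filter_eq', Multiset.map_replicate,
      Multiset.prod_replicate, count_roots]
    ring
  rw [localDeriv_eq_eval h, eval_mul, eval_C, eval_multiset_prod, Multiset.map_map]
  simp

/-- The separation is `‖y - z‖` for another root `z`, and the Mahler measure bounds `y` and `z`.
If there is no other root, then `sep y f = 0` and the logarithm vanishes. -/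
lemma posLog_sep_le {y : ℂ} (hy : y ∈ f.roots) :
    log⁺ (sep y f) ≤ log 2 + 2 * (logSize f - log ‖f.leadingCoeff‖) := by
  have hf := ne_zero_of_mem_roots hy
  have h1 := posLog_norm_le_of_mem_roots f hy
  have h0 : 0 ≤ log⁺ ‖y‖ := posLog_nonneg
  have h2 := (log_pos one_lt_two).le
  by_cases h : f.roots.filter (· ≠ y) = 0
  · rw [sep_eq_zero_of_filter_eq_zero f h hf, posLog_zero]
    linarith
  · obtain ⟨z, hz, hs⟩ := exists_sep_eq f hf h
    have h3 := posLog_norm_le_of_mem_roots f (Multiset.mem_filter.1 hz).1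
    rw [hs]
    refine max_le (by linarith) ((log_norm_sub_le y z).trans (by linarith))

/-- The local derivative at `y` is the product of the leading coefficient and of the differences
`y - z`, one of which has absolute value `sep y f`. -/
lemma log_localDeriv_le {y : ℂ} (hy : y ∈ f.roots) :
    log ‖localDeriv f y‖ ≤
      log (sep y f) + f.natDegree * log 2 + f.natDegree * log⁺ ‖y‖ + logSize f := by
  have hf := ne_zero_of_mem_roots hy
  have hlc : f.leadingCoeff ≠ 0 := leadingCoeff_ne_zero.2 hf
  have h2 := (log_pos one_lt_two).le
  have h0 : 0 ≤ log⁺ ‖y‖ := posLog_nonneg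
  rw [localDeriv_eq_prod]
  by_cases h : f.roots.filter (· ≠ y) = 0
  · rw [sep_eq_zero_of_filter_eq_zero f h hf, h]
    have := log_leadingCoeff_le_logSize f
    simp only [Multiset.map_zero, Multiset.prod_zero, mul_one, log_zero]
    have : 0 ≤ f.natDegree * log 2 := by positivity
    have : 0 ≤ f.natDegree * log⁺ ‖y‖ := by positivity
    linarith
  · obtain ⟨z, hz, hs⟩ := exists_sep_eq f hf h
    set s := f.roots.filter (· ≠ y) with hsdef
    have hsy : ∀ w ∈ s, y - w ≠ 0 := fun w hw =>
      sub_ne_zero.2 (Ne.symm (Multiset.mem_filter.1 hw).2)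
    have hb : (s.map fun w => log ‖y - w‖).sum ≤ log (sep y f) +
        ((s.erase z).map fun w => log 2 + log⁺ ‖y‖ + log⁺ ‖w‖).sum := by
      rw [← Multiset.cons_erase hz, Multiset.map_cons, Multiset.sum_cons, hs,
        Multiset.cons_erase hz]
      exact add_le_add le_rfl (Multiset.sum_map_le_sum_map _ _ fun w _ => log_norm_sub_le y w)
    have hmono : ((s.erase z).map fun w => log 2 + log⁺ ‖y‖ + log⁺ ‖w‖).sum ≤
        (f.roots.map fun w => log 2 + log⁺ ‖y‖ + log⁺ ‖w‖).sum := by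
      obtain ⟨u, hu⟩ := Multiset.le_iff_exists_add.1
        ((Multiset.erase_le z s).trans (Multiset.filter_le _ _))
      rw [hu, Multiset.map_add, Multiset.sum_add]
      refine le_add_of_nonneg_right (Multiset.sum_nonneg fun t ht => ?_)
      obtain ⟨w, _, rfl⟩ := Multiset.mem_map.1 ht
      have : 0 ≤ log⁺ ‖w‖ := posLog_nonneg
      linarith
    have hsum : (f.roots.map fun w => log 2 + log⁺ ‖y‖ + log⁺ ‖w‖).sum =
        f.natDegree * (log 2 + log⁺ ‖y‖) + (f.roots.map fun w => log⁺ ‖w‖).sum := by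
      rw [Multiset.sum_map_add, sum_roots_const]
    have hM := log_leadingCoeff_add_sum_le_logSize f
    rw [norm_mul, log_mul (by simpa using hlc), log_norm_prod_map hsy]
    · linarith
    · refine norm_ne_zero_iff.2 (Multiset.prod_ne_zero fun h0 => ?_)
      obtain ⟨w, hw, hw0⟩ := Multiset.mem_map.1 h0
      exact hsy w hw hw0

/-- `|log s| = 2 log⁺ s - log s`: the first term is controlled by the sizes of the roots, the second
by the local derivatives. -/
lemma lsep_le : lsep f * log 2 ≤ 3 * f.natDegree ^ 2 * log 2 + 7 * (f.natDegree * logSize f)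
    - 4 * log ‖f.leadingCoeff ^ f.natDegree‖
    - log ‖f.leadingCoeff ^ f.natDegree * gdisc f‖ := by
  by_cases hf : f = 0
  · simp [hf, lsep, gdisc]
  have hlc : f.leadingCoeff ≠ 0 := leadingCoeff_ne_zero.2 hf
  have h1 : lsep f * log 2 = (f.roots.map fun y => |log (sep y f)|).sum := by
    have := sum_toFinset_rootMultiplicity f fun y => sep y f
    rw [eq_div_iff (log_pos one_lt_two).ne'] at this
    rw [← this]
    unfold lsep
    congr!
  have h2 : (f.roots.map fun y => |log (sep y f)|).sum ≤
      (f.roots.map fun y => (2 * (log 2 + 2 * (logSize f - log ‖f.leadingCoeff‖)) +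
        f.natDegree * log 2 + logSize f + f.natDegree * log⁺ ‖y‖) + -log ‖localDeriv f y‖).sum := by
    refine Multiset.sum_map_le_sum_map _ _ fun y hy => ?_
    rw [abs_log_eq]
    have := posLog_sep_le f hy
    have := log_localDeriv_le f hy
    linarith
  rw [Multiset.sum_map_add, Multiset.sum_map_add, sum_roots_const, Multiset.sum_map_mul_left,
    Multiset.sum_map_neg, sum_log_localDeriv] at h2
  rw [h1, norm_mul, log_mul (by simp [hlc]) (by simp [gdisc_ne_zero]), norm_pow, log_pow]
  have h3 := mul_le_mul_of_nonneg_left (log_leadingCoeff_add_sum_le_logSize f)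
    (Nat.cast_nonneg (α := ℝ) f.natDegree)
  have h4 : (f.natDegree : ℝ) * log 2 ≤ f.natDegree ^ 2 * log 2 := by
    refine mul_le_mul_of_nonneg_right ?_ (log_pos one_lt_two).le
    exact_mod_cast Nat.le_self_pow two_ne_zero _
  have h5 := mul_nonneg (Nat.cast_nonneg (α := ℝ) f.natDegree) (logSize_nonneg f)
  linarith

end Univariate

/-! ### Sizes of specializations -/

section Sizes

open Real

variable {n : ℕ}

lemma one_le_supNorm {f : ℤ[X]} (hf : f ≠ 0) : 1 ≤ f.supNorm := by
  refine le_trans ?_ (f.le_supNorm f.natDegree)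
  rw [coeff_natDegree, Int.norm_eq_abs]
  exact_mod_cast Int.one_le_abs (leadingCoeff_ne_zero.2 hf)

lemma log_leadingCoeff_le_log_supNorm {f : ℤ[X]} (hf : f ≠ 0) :
    log |(f.leadingCoeff : ℝ)| ≤ log f.supNorm := by
  refine log_le_log ?_ ?_
  · exact abs_pos.2 (Int.cast_ne_zero.2 (leadingCoeff_ne_zero.2 hf))
  · rw [← Int.norm_eq_abs, ← coeff_natDegree]
    exact f.le_supNorm f.natDegree

lemma one_le_mvSupNorm {σ : Type*} {F : MvPolynomial σ ℤ} (hF : F ≠ 0) : 1 ≤ mvSupNorm F := by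
  obtain ⟨m, hm⟩ := MvPolynomial.support_nonempty.2 hF
  exact (Int.natAbs_pos.2 (MvPolynomial.mem_support_iff.1 hm)).trans_le
    (Finset.le_sup (f := fun m => (F.coeff m).natAbs) hm)

lemma natAbs_coeff_le_mvSupNorm {σ : Type*} (F : MvPolynomial σ ℤ) (m : σ →₀ ℕ) :
    (F.coeff m).natAbs ≤ mvSupNorm F := by
  by_cases hm : m ∈ F.support
  · exact Finset.le_sup (f := fun m => (F.coeff m).natAbs) hm
  · simp [MvPolynomial.notMem_support_iff.1 hm]

lemma card_support_le (F : MvPolynomial (Option (Fin n)) ℤ) :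
    F.support.card ≤ (F.totalDegree + 1) ^ (n + 1) := by
  have h : F.support.card ≤
      (Fintype.piFinset fun _ : Option (Fin n) => Finset.range (F.totalDegree + 1)).card := by
    refine Finset.card_le_card_of_injOn (fun m => ⇑m) (fun m hm => ?_)
      (DFunLike.coe_injective.injOn)
    refine Fintype.mem_piFinset.2 fun o => Finset.mem_range.2 (Nat.lt_succ_of_le ?_)
    change m o ≤ _
    have h1 := le_totalDegree_of_mem_support (Finset.mem_coe.1 hm)
    cases o with
    | none => omega
    | some i =>
      have h2 := Finset.single_le_sum (f := fun i => m (some i)) (fun _ _ => Nat.zero_le _)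
        (Finset.mem_univ i)
      omega
  simpa using h

/-- If all coordinates of `x` are bounded by `B ≥ 1`, each of the at most `(d + 1) ^ (n + 1)`
monomials of `F` contributes at most `‖F‖∞ B ^ d`. -/
lemma sum_norm_coeff_specializeAt_le (F : MvPolynomial (Option (Fin n)) ℤ) (x : Fin n → ℂ) {B : ℝ}
    (hB : 1 ≤ B) (hx : ∀ i, ‖x i‖ ≤ B) :
    ((specializeAt F x).sum fun _ a => ‖a‖) ≤
      (F.totalDegree + 1) ^ (n + 1) * (mvSupNorm F * B ^ F.totalDegree) := by
  have hterm : ∀ m ∈ F.support, ‖((F.coeff m : ℤ) : ℂ) * ∏ i, x i ^ m (some i)‖ ≤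
      mvSupNorm F * B ^ F.totalDegree := by
    intro m hm
    rw [norm_mul, Complex.norm_intCast, norm_prod]
    refine mul_le_mul ?_ ?_ (Finset.prod_nonneg fun _ _ => norm_nonneg _) (Nat.cast_nonneg _)
    · rw [← Int.cast_abs, Int.abs_eq_natAbs]
      exact_mod_cast natAbs_coeff_le_mvSupNorm F m
    · calc ∏ i, ‖x i ^ m (some i)‖ ≤ ∏ i, B ^ m (some i) := by
            refine Finset.prod_le_prod (fun _ _ => norm_nonneg _) fun i _ => ?_
            rw [norm_pow]
            exact pow_le_pow_left₀ (norm_nonneg _) (hx i) _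
        _ = B ^ ∑ i, m (some i) := Finset.prod_pow_eq_pow_sum _ _ _
        _ ≤ B ^ F.totalDegree := pow_le_pow_right₀ hB
            ((Nat.le_add_left _ _).trans (le_totalDegree_of_mem_support hm))
  calc ((specializeAt F x).sum fun _ a => ‖a‖)
      ≤ ∑ k ∈ (specializeAt F x).support, ∑ m ∈ F.support,
          if k = m none then ‖((F.coeff m : ℤ) : ℂ) * ∏ i, x i ^ m (some i)‖ else 0 := by
        rw [sum_def]
        refine Finset.sum_le_sum fun k _ => ?_
        rw [coeff_specializeAt]
        refine (norm_sum_le _ _).trans (Finset.sum_le_sum fun m _ => ?_)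
        split_ifs <;> simp
    _ ≤ ∑ m ∈ F.support, ‖((F.coeff m : ℤ) : ℂ) * ∏ i, x i ^ m (some i)‖ := by
        rw [Finset.sum_comm]
        refine Finset.sum_le_sum fun m _ => ?_
        rw [Finset.sum_ite_eq']
        split_ifs
        exacts [le_rfl, norm_nonneg _]
    _ ≤ F.support.card * (mvSupNorm F * B ^ F.totalDegree) := by
        rw [← nsmul_eq_mul]
        exact Finset.sum_le_card_nsmul _ _ _ hterm
    _ ≤ _ := by
        have : (F.support.card : ℝ) ≤ (F.totalDegree + 1) ^ (n + 1) := by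
          exact_mod_cast card_support_le F
        gcongr

/-- Scaling the coordinates by `2n` before truncating at `1` keeps the last sum small on average
over the grid, at the cost of the term `d log (2n)`. -/
lemma logSize_specializeAt_le (hn : 1 ≤ n) {F : MvPolynomial (Option (Fin n)) ℤ} (hF : F ≠ 0)
    {d : ℕ} (hd : F.totalDegree ≤ d) (x : Fin n → ℂ) :
    logSize (specializeAt F x) ≤ (n + 1) * log (d + 1) + log (mvSupNorm F) + d * log (2 * n) +
      d * ∑ i, log⁺ (‖x i‖ / (2 * n)) := by
  have hn' : (1 : ℝ) ≤ n := by exact_mod_cast hn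
  have hr : (0 : ℝ) < 2 * n := by linarith
  set p : ℝ := ∏ i, max 1 (‖x i‖ / (2 * n)) with hp
  have hprod : ∀ s : Finset (Fin n), 1 ≤ ∏ i ∈ s, max 1 (‖x i‖ / (2 * n)) := fun s =>
    Finset.prod_induction _ (1 ≤ ·) (fun _ _ => one_le_mul_of_one_le_of_one_le) le_rfl
      fun i _ => le_max_left _ _
  have hp1 : 1 ≤ p := hprod _
  have hxB : ∀ i, ‖x i‖ ≤ 2 * n * p := by
    intro i
    rw [← div_le_iff₀' hr, hp]
    refine (le_max_right 1 _).trans ?_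
    rw [← Finset.mul_prod_erase _ _ (Finset.mem_univ i)]
    exact le_mul_of_one_le_right (zero_le_one.trans (le_max_left _ _)) (hprod _)
  have hB1 : 1 ≤ 2 * n * p := one_le_mul_of_one_le_of_one_le (by linarith) hp1
  have hS : (1 : ℝ) ≤ mvSupNorm F := by exact_mod_cast one_le_mvSupNorm hF
  have h := sum_norm_coeff_specializeAt_le F x hB1 hxB
  have h' : ((specializeAt F x).sum fun _ a => ‖a‖) ≤
      (d + 1) ^ (n + 1) * (mvSupNorm F * (2 * n * p) ^ d) := by
    refine h.trans ?_
    have : (F.totalDegree : ℝ) ≤ d := by exact_mod_cast hd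
    gcongr
  have h0 : 0 ≤ ((specializeAt F x).sum fun _ a => ‖a‖) := by
    rw [sum_def]; exact Finset.sum_nonneg fun _ _ => norm_nonneg _
  refine (posLog_le_posLog h0 h').trans ?_
  have hd1 : (1 : ℝ) ≤ d + 1 := by linarith [Nat.cast_nonneg (α := ℝ) d]
  have hge : 1 ≤ ((d : ℝ) + 1) ^ (n + 1) * (mvSupNorm F * (2 * n * p) ^ d) :=
    one_le_mul_of_one_le_of_one_le (one_le_pow₀ hd1)
      (one_le_mul_of_one_le_of_one_le hS (one_le_pow₀ hB1))
  have hp0 : 0 < p := by linarith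
  rw [posLog_eq_log (hge.trans (le_abs_self _)), log_mul (by positivity) (by positivity),
    log_mul (by positivity) (by positivity), log_pow, log_pow, log_mul hr.ne' hp0.ne', hp, log_prod]
  · simp only [posLog_eq_log_max_one (div_nonneg (norm_nonneg _) hr.le)]
    push_cast
    linarith
  · exact fun i _ => (zero_lt_one.trans_le (le_max_left _ _)).ne'

/-- By Landau's bound for the Mahler measure of the polynomial `r ^ (-deg f) f(r X)`, whose
coefficients are bounded by a geometric series, truncating the roots at `r` instead of `1` replaces
the factor depending on the degree by `(1 - r⁻¹)⁻¹`. -/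
lemma sum_posLog_roots_div_le {f : ℤ[X]} (hf : f ≠ 0) {r : ℝ} (hr : 1 < r) :
    ((f.map (Int.castRingHom ℂ)).roots.map fun y => log⁺ (‖y‖ / r)).sum ≤
      log f.supNorm + 1 / (r - 1) := by
  have hr0 : 0 < r := by linarith
  have hrinv : r⁻¹ < 1 := inv_lt_one_of_one_lt₀ hr
  have hrinv0 : 0 < r⁻¹ := inv_pos.2 hr0
  set c : ℂ := ((r⁻¹ : ℝ) : ℂ) with hc
  have hcn : ‖c‖ = r⁻¹ := by rw [hc, Complex.norm_real, norm_of_nonneg hrinv0.le]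
  have hc0 : c ≠ 0 := by rw [← norm_ne_zero_iff, hcn]; exact hrinv0.ne'
  set p := f.map (Int.castRingHom ℂ) with hp
  have hp0 : p ≠ 0 := (Polynomial.map_ne_zero_iff (RingHom.injective_int _)).2 hf
  set q := p.scaleRoots c with hq
  have hq0 : q ≠ 0 := scaleRoots_ne_zero hp0 c
  have hroots : (q.roots.map fun y => log⁺ ‖y‖).sum =
      (p.roots.map fun y => log⁺ (‖y‖ / r)).sum := by
    rw [hq, roots_scaleRoots _ (isUnit_iff_ne_zero.2 hc0), Multiset.map_map]
    refine congrArg _ (Multiset.map_congr rfl fun y _ => ?_)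
    rw [Function.comp_apply, norm_mul, hcn, inv_mul_eq_div]
  have hlc : 0 ≤ log ‖q.leadingCoeff‖ := by
    refine log_nonneg ?_
    rw [hq, leadingCoeff_scaleRoots, hp, leadingCoeff_map_of_injective (RingHom.injective_int _),
      eq_intCast, Complex.norm_intCast]
    exact_mod_cast Int.one_le_abs (leadingCoeff_ne_zero.2 hf)
  have hsum : (q.sum fun _ a => ‖a‖) ≤ f.supNorm * (1 - r⁻¹)⁻¹ := by
    rw [sum_over_range _ (by simp), hq, natDegree_scaleRoots]
    calc _ ≤ ∑ k ∈ Finset.range (p.natDegree + 1), f.supNorm * r⁻¹ ^ (p.natDegree - k) := by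
          refine Finset.sum_le_sum fun k _ => ?_
          rw [coeff_scaleRoots, norm_mul, norm_pow, hcn]
          refine mul_le_mul_of_nonneg_right ?_ (by positivity)
          rw [hp, coeff_map, eq_intCast, Complex.norm_intCast, ← Int.norm_eq_abs]
          exact f.le_supNorm k
      _ = f.supNorm * ∑ k ∈ Finset.range (p.natDegree + 1), r⁻¹ ^ k := by
          rw [← Finset.mul_sum, ← Finset.sum_range_reflect fun k => r⁻¹ ^ k]
          refine congrArg _ (Finset.sum_congr rfl fun k _ => ?_)
          congr 1
      _ ≤ _ := by
          refine mul_le_mul_of_nonneg_left ?_ f.supNorm_nonneg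
          rw [← tsum_geometric_of_lt_one hrinv0.le hrinv]
          exact (summable_geometric_of_lt_one hrinv0.le hrinv).sum_le_tsum _
            fun _ _ => by positivity
  have hS := one_le_supNorm hf
  have hmain := logMahlerMeasure_eq_log_leadingCoeff_add_sum_log_roots q
  rw [logMahlerMeasure_eq_log_MahlerMeasure, hroots] at hmain
  have hle := log_le_log (mahlerMeasure_pos_of_ne_zero hq0)
    ((mahlerMeasure_le_sum_norm_coeff q).trans hsum)
  rw [log_mul (by linarith) (inv_ne_zero (by linarith))] at hle
  have hlog : log (1 - r⁻¹)⁻¹ ≤ 1 / (r - 1) := by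
    refine (log_le_sub_one_of_pos (inv_pos.2 (by linarith))).trans (le_of_eq ?_)
    have : r - 1 ≠ 0 := by linarith
    field_simp
    ring
  linarith

lemma cofactor_rootsIn_le {Fs : Fin n → ℤ[X]} {M : ℕ} (hM : ∀ i, (Fs i).natDegree ≤ M)
    (i : Fin n) : cofactor (rootsIn ℂ Fs) i ≤ M ^ (n - 1) := by
  unfold cofactor
  refine (Finset.prod_le_pow_card _ _ M fun j _ => by rw [card_rootsIn]; exact hM j).trans ?_
  simp

lemma sum_gridCount_rootsIn_le {Fs : Fin n → ℤ[X]} {M : ℕ} (hM : ∀ i, (Fs i).natDegree ≤ M) :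
    ∑ x ∈ grid (rootsIn ℂ Fs), gridCount (rootsIn ℂ Fs) x ≤ M ^ n := by
  rw [sum_gridCount]
  refine (Finset.prod_le_pow_card _ _ M fun j _ => by rw [card_rootsIn]; exact hM j).trans ?_
  simp

/-- The amortized bound on the sizes of the specializations `F(x, Y)`. -/
lemma sum_logSize_le (hn : 1 ≤ n) {Fs : Fin n → ℤ[X]} (hFs : ∀ i, Fs i ≠ 0) {M d : ℕ} {Λ τ : ℝ}
    (hM : ∀ i, (Fs i).natDegree ≤ M) (hΛ : ∀ i, log (Fs i).supNorm ≤ Λ)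
    {F : MvPolynomial (Option (Fin n)) ℤ} (hF : F ≠ 0) (hd : F.totalDegree ≤ d)
    (hτ : log (mvSupNorm F) ≤ τ) :
    ∑ x ∈ grid (rootsIn ℂ Fs), (gridCount (rootsIn ℂ Fs) x : ℝ) * logSize (specializeAt F x) ≤
      M ^ n * ((n + 1) * log (d + 1) + τ + d * log (2 * n)) + d * M ^ (n - 1) * (n * Λ + 1) := by
  have hn' : (1 : ℝ) ≤ n := by exact_mod_cast hn
  set R := rootsIn ℂ Fs with hR
  set c : ℝ := (n + 1) * log (d + 1) + τ + d * log (2 * n) with hc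
  have hτ0 : 0 ≤ τ := (log_nonneg (by exact_mod_cast one_le_mvSupNorm hF)).trans hτ
  have hc0 : 0 ≤ c := by
    have h1 : 0 ≤ log ((d : ℝ) + 1) := log_nonneg (by linarith [Nat.cast_nonneg (α := ℝ) d])
    have h2 : 0 ≤ log (2 * (n : ℝ)) := log_nonneg (by linarith)
    positivity
  calc _ ≤ ∑ x ∈ grid R, ((gridCount R x : ℝ) * c +
        d * ∑ i, (gridCount R x : ℝ) * log⁺ (‖x i‖ / (2 * n))) := by
        refine Finset.sum_le_sum fun x _ => ?_
        have h := logSize_specializeAt_le hn hF hd x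
        rw [← Finset.mul_sum, mul_left_comm, ← mul_add]
        refine mul_le_mul_of_nonneg_left ?_ (Nat.cast_nonneg _)
        linarith
    _ = (∑ x ∈ grid R, gridCount R x : ℕ) * c +
        d * ∑ i, (cofactor R i : ℝ) * ((R i).map fun y => log⁺ (‖y‖ / (2 * n))).sum := by
        rw [Finset.sum_add_distrib, ← Finset.sum_mul, ← Finset.mul_sum, Finset.sum_comm]
        push_cast
        congr 2
        exact Finset.sum_congr rfl fun i _ => sum_grid_apply R i fun y => log⁺ (‖y‖ / (2 * n))
    _ ≤ M ^ n * c + d * ∑ i : Fin n, (M : ℝ) ^ (n - 1) * (Λ + 1 / n) := by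
        refine add_le_add (mul_le_mul_of_nonneg_right ?_ hc0)
          (mul_le_mul_of_nonneg_left (Finset.sum_le_sum fun i _ => ?_) (Nat.cast_nonneg _))
        · exact_mod_cast sum_gridCount_rootsIn_le hM
        · refine mul_le_mul ?_ ?_ ?_ (by positivity)
          · exact_mod_cast cofactor_rootsIn_le hM i
          -- Scaling by `2n` makes the `n` error terms `1 / (2n - 1)` add up to at most `1`.
          · have h := sum_posLog_roots_div_le (hFs i) (r := 2 * n) (by linarith)
            have h2 : 1 / (2 * (n : ℝ) - 1) ≤ 1 / n :=
              one_div_le_one_div_of_le (by linarith) (by linarith)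
            have h3 := hΛ i
            exact h.trans (by linarith)
          · refine Multiset.sum_nonneg fun t ht => ?_
            obtain ⟨y, _, rfl⟩ := Multiset.mem_map.1 ht
            exact posLog_nonneg
    _ = _ := by
        rw [Finset.sum_const, Finset.card_univ, Fintype.card_fin, nsmul_eq_mul]
        have : (n : ℝ) ≠ 0 := by linarith
        field_simp

end Sizes

/-! ### The variety and the local multiplicities -/

section Multiplicity

variable {n : ℕ}

lemma complexExt_systemIdeal (Fs : Fin n → ℤ[X]) :
    complexExt (systemIdeal Fs) = Ideal.span (Set.range fun i =>
      aeval (MvPolynomial.X i : MvPolynomial (Fin n) ℂ) ((Fs i).map (Int.castRingHom ℂ))) := by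
  unfold complexExt systemIdeal
  rw [Ideal.map_span, ← Set.range_comp]
  congr 2
  funext i
  simp only [Function.comp_apply, aeval_def, hom_eval₂, eval₂_map, MvPolynomial.map_X]
  congr 1
  exact RingHom.ext_int _ _

lemma mem_rootsIn_complex {Fs : Fin n → ℤ[X]} (hFs : ∀ i, Fs i ≠ 0) {i : Fin n} {y : ℂ} :
    y ∈ rootsIn ℂ Fs i ↔ ((Fs i).map (Int.castRingHom ℂ)).eval y = 0 := by
  have : (Fs i).map (Int.castRingHom ℂ) ≠ 0 :=
    (Polynomial.map_ne_zero_iff (RingHom.injective_int _)).2 (hFs i)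
  rw [rootsIn, mem_roots this, IsRoot.def]

lemma complexVariety_systemIdeal {Fs : Fin n → ℤ[X]} (hFs : ∀ i, Fs i ≠ 0) :
    complexVariety (systemIdeal Fs) = ↑(grid (rootsIn ℂ Fs)) := by
  ext x
  rw [complexVariety, complexExt_systemIdeal, MvPolynomial.zeroLocus_span, Finset.mem_coe, mem_grid]
  simp only [Set.mem_ofPred_eq, Set.forall_mem_range, mem_rootsIn_complex hFs]
  refine forall_congr' fun i => ?_
  rw [← aeval_algHom_apply, MvPolynomial.aeval_X, coe_aeval_eq_eval]

/-- If the ideal contains `(Xᵢ - xᵢ) ^ μᵢ` up to a unit at `x` for every `i`, the local quotient is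
spanned by the monomials in the `Xᵢ - xᵢ` with exponents less than `μᵢ`. The span `S` of these
monomials is stable under multiplication by polynomials, and since it is finite-dimensional, a
denominator acts on it bijectively. -/
lemma span_monomials_eq_top {x : Fin n → ℂ} {J : Ideal (LocalRingAt x)} {μ : Fin n → ℕ}
    (hμ : ∀ i, 0 < μ i)
    (hJ : ∀ i, algebraMap (MvPolynomial (Fin n) ℂ) (LocalRingAt x)
      ((MvPolynomial.X i - MvPolynomial.C (x i)) ^ μ i) ∈ J) :
    Submodule.span ℂ (Set.range fun e : (∀ i, Fin (μ i)) =>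
      Ideal.Quotient.mk J (algebraMap (MvPolynomial (Fin n) ℂ) (LocalRingAt x)
        (∏ i, (MvPolynomial.X i - MvPolynomial.C (x i)) ^ (e i : ℕ)))) = ⊤ := by
  let π : MvPolynomial (Fin n) ℂ →ₐ[ℂ] LocalRingAt x ⧸ J :=
    (Ideal.Quotient.mkₐ ℂ J).comp (Algebra.algHom ℂ _ _)
  let t : Fin n → LocalRingAt x ⧸ J := fun i => π (MvPolynomial.X i - MvPolynomial.C (x i))
  have ht : ∀ i, t i ^ μ i = 0 := fun i => by
    rw [← map_pow]
    exact Ideal.Quotient.eq_zero_iff_mem.2 (hJ i)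
  have hv : (fun e : (∀ i, Fin (μ i)) =>
      Ideal.Quotient.mk J (algebraMap (MvPolynomial (Fin n) ℂ) (LocalRingAt x)
        (∏ i, (MvPolynomial.X i - MvPolynomial.C (x i)) ^ (e i : ℕ)))) =
      fun e => ∏ i, t i ^ (e i : ℕ) := by
    funext e
    change π _ = _
    simp only [map_prod, map_pow, t]
  rw [hv]
  set S := Submodule.span ℂ (Set.range fun e : (∀ i, Fin (μ i)) => ∏ i, t i ^ (e i : ℕ)) with hS
  have hone : (1 : LocalRingAt x ⧸ J) ∈ S :=
    Submodule.subset_span ⟨fun i => ⟨0, hμ i⟩, by simp⟩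
  have hmono : ∀ e : Fin n → ℕ, ∏ i, t i ^ e i ∈ S := by
    intro e
    by_cases he : ∀ i, e i < μ i
    · exact Submodule.subset_span ⟨fun i => ⟨e i, he i⟩, rfl⟩
    · push Not at he
      obtain ⟨i, hi⟩ := he
      have h0 : t i ^ e i = 0 := pow_eq_zero_of_le hi (ht i)
      rw [Finset.prod_eq_zero (f := fun i => t i ^ e i) (Finset.mem_univ i) h0]
      exact S.zero_mem
  have hmul : ∀ i, ∀ z ∈ S, t i * z ∈ S := by
    intro i z hz
    induction hz using Submodule.span_induction with
    | mem z hz =>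
      obtain ⟨e, rfl⟩ := hz
      have h1 : t i * ∏ j, t j ^ (e j : ℕ) = ∏ j, t j ^ ((e j : ℕ) + if j = i then 1 else 0) := by
        simp only [pow_add, Finset.prod_mul_distrib, pow_ite, pow_one, pow_zero,
          Finset.prod_ite_eq', Finset.mem_univ, if_true]
        exact mul_comm (G := LocalRingAt x ⧸ J) _ _
      simp only [h1]
      exact hmono _
    | zero => simp
    | add a b _ _ ha hb => rw [mul_add]; exact S.add_mem ha hb
    | smul c a _ ha => rw [mul_smul_comm]; exact S.smul_mem c ha
  have hpoly : ∀ (p : MvPolynomial (Fin n) ℂ), ∀ z ∈ S, π p * z ∈ S := by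
    intro p
    induction p using MvPolynomial.induction_on with
    | C a =>
      intro z hz
      rw [← MvPolynomial.algebraMap_eq, AlgHom.commutes, ← Algebra.smul_def]
      exact S.smul_mem a hz
    | add p q hp hq =>
      intro z hz
      rw [map_add, add_mul]
      exact S.add_mem (hp z hz) (hq z hz)
    | mul_X p i hp =>
      intro z hz
      have hX : π (MvPolynomial.X i) = t i + algebraMap ℂ _ (x i) := by
        rw [← π.commutes, MvPolynomial.algebraMap_eq, ← map_add, sub_add_cancel]
      rw [map_mul, mul_assoc, hX, add_mul, ← Algebra.smul_def]
      exact hp _ (S.add_mem (hmul i z hz) (S.smul_mem _ hz))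
  have : FiniteDimensional ℂ S := FiniteDimensional.span_of_finite ℂ (Set.finite_range _)
  rw [eq_top_iff]
  rintro z -
  obtain ⟨w, rfl⟩ := Ideal.Quotient.mk_surjective z
  obtain ⟨⟨p, s⟩, hps⟩ := IsLocalization.surj
    (MvPolynomial.vanishingIdeal ℂ ({x} : Set (Fin n → ℂ))).primeCompl w
  have hps' : Ideal.Quotient.mk J w * π s = π p := congrArg (Ideal.Quotient.mk J) hps
  have hunit : IsUnit (π s) :=
    (IsLocalization.map_units (LocalRingAt x) s).map (Ideal.Quotient.mk J)
  let f : S →ₗ[ℂ] S := (LinearMap.mulLeft ℂ (π s)).restrict (hpoly s)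
  have hinj : Function.Injective f := by
    intro a b hab
    have : π s * a = π s * b := congrArg Subtype.val hab
    exact Subtype.ext (hunit.mul_left_cancel this)
  obtain ⟨b, hb⟩ := LinearMap.injective_iff_surjective.1 hinj ⟨1, hone⟩
  have hb' : π s * b = 1 := congrArg Subtype.val hb
  have : Ideal.Quotient.mk J w = π p * b := by
    rw [← hps', mul_assoc, hb', mul_one]
  rw [this]
  exact hpoly p _ b.2

lemma rootMult_le_gridCount {Fs : Fin n → ℤ[X]} (hFs : ∀ i, Fs i ≠ 0) {x : Fin n → ℂ}
    (hx : x ∈ grid (rootsIn ℂ Fs)) :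
    rootMult (systemIdeal Fs) x ≤ gridCount (rootsIn ℂ Fs) x := by
  set μ : Fin n → ℕ := fun i => (rootsIn ℂ Fs i).count (x i) with hμ
  set J := (complexExt (systemIdeal Fs)).map
    (algebraMap (MvPolynomial (Fin n) ℂ) (LocalRingAt x)) with hJ
  have hmem : ∀ i, algebraMap (MvPolynomial (Fin n) ℂ) (LocalRingAt x)
      ((MvPolynomial.X i - MvPolynomial.C (x i)) ^ μ i) ∈ J := by
    intro i
    set f := (Fs i).map (Int.castRingHom ℂ) with hf
    have hf0 : f ≠ 0 := (Polynomial.map_ne_zero_iff (RingHom.injective_int _)).2 (hFs i)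
    set g := f /ₘ (X - C (x i)) ^ f.rootMultiplicity (x i) with hg
    have hfg : (X - C (x i)) ^ μ i * g = f := by
      rw [hμ, hg]
      simp only [rootsIn, count_roots, ← hf]
      exact pow_mul_divByMonic_rootMultiplicity_eq f (x i)
    have hgx : g.eval (x i) ≠ 0 := eval_divByMonic_pow_rootMultiplicity_ne_zero (x i) hf0
    have hfJ : algebraMap (MvPolynomial (Fin n) ℂ) (LocalRingAt x)
        (aeval (MvPolynomial.X i) f) ∈ J := by
      refine Ideal.mem_map_of_mem _ ?_
      rw [complexExt_systemIdeal]
      exact Ideal.subset_span ⟨i, rfl⟩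
    have hunit : IsUnit (algebraMap (MvPolynomial (Fin n) ℂ) (LocalRingAt x)
        (aeval (MvPolynomial.X i) g)) := by
      refine IsLocalization.map_units (M := (MvPolynomial.vanishingIdeal ℂ
        ({x} : Set (Fin n → ℂ))).primeCompl) (LocalRingAt x) ⟨_, ?_⟩
      rw [Ideal.mem_primeCompl_iff, MvPolynomial.mem_vanishingIdeal_singleton_iff,
        ← aeval_algHom_apply, MvPolynomial.aeval_X, coe_aeval_eq_eval]
      exact hgx
    rw [← hfg, map_mul, map_mul] at hfJ
    rw [J.mul_unit_mem_iff_mem hunit] at hfJ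
    simpa [MvPolynomial.algebraMap_eq] using hfJ
  have hpos : ∀ i, 0 < μ i := fun i => Multiset.count_pos.2 (mem_grid.1 hx i)
  have h := finrank_le_of_span_eq_top (span_monomials_eq_top hpos hmem)
  rw [Fintype.card_pi] at h
  simpa [rootMult, gridCount] using h

end Multiplicity

/-! ### The amortized bounds -/

section Amortized

open Real

variable {n : ℕ}

/-- The Galois-theoretic lower bound, with the contribution of the leading coefficients of the
`Fs i` estimated by their bitsizes. -/
lemma sum_log_norm_specialize_ge_of_size {Fs : Fin n → ℤ[X]} (hFs : ∀ i, Fs i ≠ 0) {M : ℕ} {Λ : ℝ}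
    (hM : ∀ i, (Fs i).natDegree ≤ M) (hΛ : ∀ i, log (Fs i).supNorm ≤ Λ)
    (F : MvPolynomial (Option (Fin n)) ℤ) (E : ℕ)
    (g : ∀ (K : Type) [Field K], K[X] → K)
    (hg : ∀ (K : Type) [Field K] (f : K[X]), g K f ≠ 0)
    (hmap : ∀ (K K' : Type) [Field K] [IsAlgClosed K] [Field K'] (ψ : K →+* K') (f : K[X]),
      g K' (f.map ψ) = ψ (g K f))
    (hval : ∀ (K : Type) [Field K] [IsAlgClosed K] (V : ValuationSubring K) (x : Fin n → K),
      V.valuation (g K (specializeAt F x)) ≤ (∏ i, max 1 (V.valuation (x i))) ^ E) :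
    -(E * (n * (M ^ (n - 1) * Λ))) ≤ ∑ x ∈ grid (rootsIn ℂ Fs), (gridCount (rootsIn ℂ Fs) x : ℝ) *
        log ‖g ℂ (specializeAt F x)‖ := by
  refine le_trans (neg_le_neg ?_) (sum_log_norm_specialize_ge Fs hFs F E g hg hmap hval)
  calc _ ≤ ∑ _i : Fin n, E * ((M : ℝ) ^ (n - 1) * Λ) := by
        refine Finset.sum_le_sum fun i _ => ?_
        rw [Nat.cast_mul, mul_assoc]
        refine mul_le_mul_of_nonneg_left ?_ (Nat.cast_nonneg _)
        refine mul_le_mul ?_ ((log_leadingCoeff_le_log_supNorm (hFs i)).trans (hΛ i)) ?_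
          (by positivity)
        · exact_mod_cast cofactor_rootsIn_le hM i
        · refine log_nonneg ?_
          exact_mod_cast Int.one_le_abs (leadingCoeff_ne_zero.2 (hFs i))
    _ = _ := by
        rw [Finset.sum_const, Finset.card_univ, Fintype.card_fin, nsmul_eq_mul]
        ring

lemma one_le_prod_max {K Γ : Type*} [Field K] [LinearOrderedCommGroupWithZero Γ]
    (v : Valuation K Γ) (x : Fin n → K) : 1 ≤ ∏ i, max 1 (v (x i)) :=
  Finset.one_le_prod' fun i _ => le_max_left 1 (v (x i))

/-- The power `natDegree` of the leading coefficient is `1` for the zero polynomial, so points `x`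
with `F(x, Y) = 0` need no separate treatment. -/
lemma sum_log_leadingCoeff_pow_ge {Fs : Fin n → ℤ[X]} (hFs : ∀ i, Fs i ≠ 0) {M d : ℕ} {Λ : ℝ}
    (hM : ∀ i, (Fs i).natDegree ≤ M) (hΛ : ∀ i, log (Fs i).supNorm ≤ Λ)
    {F : MvPolynomial (Option (Fin n)) ℤ} (hd : F.totalDegree ≤ d) :
    -(d ^ 2 * (n * (M ^ (n - 1) * Λ))) ≤
      ∑ x ∈ grid (rootsIn ℂ Fs), (gridCount (rootsIn ℂ Fs) x : ℝ) *
        log ‖(specializeAt F x).leadingCoeff ^ (specializeAt F x).natDegree‖ := by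
  have h := sum_log_norm_specialize_ge_of_size hFs hM hΛ F (d ^ 2)
    (fun K _ f => f.leadingCoeff ^ f.natDegree) ?_ ?_ ?_
  · exact_mod_cast h
  · intro K _ f
    by_cases hf : f = 0
    · simp [hf]
    · exact pow_ne_zero _ (leadingCoeff_ne_zero.2 hf)
  · intro K K' _ _ _ ψ f
    simp
  · intro K _ _ V x
    rw [map_pow]
    calc _ ≤ ((∏ i, max 1 (V.valuation (x i))) ^ F.totalDegree) ^ (specializeAt F x).natDegree :=
          pow_le_pow_left' (valuation_coeff_specializeAt_le _ F x _) _
      _ ≤ _ := by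
          rw [← pow_mul, sq]
          exact pow_le_pow_right' (one_le_prod_max _ x)
            (Nat.mul_le_mul hd ((natDegree_specializeAt_le F x).trans hd))

lemma sum_log_leadingCoeff_pow_mul_gdisc_ge {Fs : Fin n → ℤ[X]} (hFs : ∀ i, Fs i ≠ 0) {M d : ℕ}
    {Λ : ℝ} (hM : ∀ i, (Fs i).natDegree ≤ M) (hΛ : ∀ i, log (Fs i).supNorm ≤ Λ)
    {F : MvPolynomial (Option (Fin n)) ℤ} (hd : F.totalDegree ≤ d) :
    -(2 * d ^ 2 * (n * (M ^ (n - 1) * Λ))) ≤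
      ∑ x ∈ grid (rootsIn ℂ Fs), (gridCount (rootsIn ℂ Fs) x : ℝ) *
        log ‖(specializeAt F x).leadingCoeff ^ (specializeAt F x).natDegree *
          gdisc (specializeAt F x)‖ := by
  have h := sum_log_norm_specialize_ge_of_size hFs hM hΛ F (2 * d ^ 2)
    (fun K _ f => f.leadingCoeff ^ f.natDegree * gdisc f) ?_ ?_ ?_
  · exact_mod_cast h
  · intro K _ f
    refine mul_ne_zero ?_ (gdisc_ne_zero f)
    by_cases hf : f = 0
    · simp [hf]
    · exact pow_ne_zero _ (leadingCoeff_ne_zero.2 hf)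
  · intro K K' _ _ _ ψ f
    simp [gdisc_map]
  · intro K _ _ V x
    refine (valuation_gdisc_le V.valuation (valuation_coeff_specializeAt_le _ F x)).trans ?_
    rw [← pow_mul]
    refine pow_le_pow_right' (one_le_prod_max _ x) ?_
    have := Nat.mul_le_mul hd ((natDegree_specializeAt_le F x).trans hd)
    nlinarith

/-- Both univariate quantities are bounded in terms of sizes and of logarithms to which the
Galois-theoretic lower bounds apply. -/
lemma sum_gridCount_mul_le (hn : 1 ≤ n) {Fs : Fin n → ℤ[X]} (hFs : ∀ i, Fs i ≠ 0) {M d : ℕ}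
    {Λ τ : ℝ} (hM : ∀ i, (Fs i).natDegree ≤ M) (hΛ : ∀ i, log (Fs i).supNorm ≤ Λ)
    {F : MvPolynomial (Option (Fin n)) ℤ} (hF : F ≠ 0) (hd : F.totalDegree ≤ d)
    (hτ : log (mvSupNorm F) ≤ τ) (q : ℂ[X] → ℝ)
    (hq : ∀ f, q f ≤ 3 * f.natDegree ^ 2 * log 2 + 7 * (f.natDegree * logSize f)
      - 4 * log ‖f.leadingCoeff ^ f.natDegree‖
      - log ‖f.leadingCoeff ^ f.natDegree * gdisc f‖) :
    ∑ x ∈ grid (rootsIn ℂ Fs), (gridCount (rootsIn ℂ Fs) x : ℝ) * q (specializeAt F x) ≤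
      3 * d ^ 2 * log 2 * M ^ n + 7 * d * (M ^ n * ((n + 1) * log (d + 1) + τ + d * log (2 * n)) +
        d * M ^ (n - 1) * (n * Λ + 1)) + 6 * d ^ 2 * (n * (M ^ (n - 1) * Λ)) := by
  set R := rootsIn ℂ Fs with hR
  have h0 := sum_log_leadingCoeff_pow_ge hFs hM hΛ hd
  have h1 := sum_log_leadingCoeff_pow_mul_gdisc_ge hFs hM hΛ hd
  have h2 := sum_logSize_le hn hFs hM hΛ hF hd hτ
  have h3 : ((∑ x ∈ grid R, gridCount R x : ℕ) : ℝ) ≤ (M : ℝ) ^ n := by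
    exact_mod_cast sum_gridCount_rootsIn_le hM
  have hlog2 := log_pos one_lt_two
  rw [← hR] at h0 h1 h2
  calc _ ≤ ∑ x ∈ grid R, (3 * d ^ 2 * log 2 * (gridCount R x : ℝ) +
        7 * d * ((gridCount R x : ℝ) * logSize (specializeAt F x)) -
        4 * ((gridCount R x : ℝ) *
          log ‖(specializeAt F x).leadingCoeff ^ (specializeAt F x).natDegree‖) -
        (gridCount R x : ℝ) * log ‖(specializeAt F x).leadingCoeff ^ (specializeAt F x).natDegree *
          gdisc (specializeAt F x)‖) := by
        refine Finset.sum_le_sum fun x _ => ?_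
        have hδ : ((specializeAt F x).natDegree : ℝ) ≤ d := by
          exact_mod_cast (natDegree_specializeAt_le F x).trans hd
        have hδ2 : ((specializeAt F x).natDegree : ℝ) ^ 2 ≤ (d : ℝ) ^ 2 := by gcongr
        have h4 := mul_le_mul_of_nonneg_right hδ (logSize_nonneg (specializeAt F x))
        have h5 := mul_le_mul_of_nonneg_right hδ2 hlog2.le
        have h6 := hq (specializeAt F x)
        calc _ ≤ (gridCount R x : ℝ) * (3 * d ^ 2 * log 2 + 7 * (d * logSize (specializeAt F x))
              - 4 * log ‖(specializeAt F x).leadingCoeff ^ (specializeAt F x).natDegree‖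
              - log ‖(specializeAt F x).leadingCoeff ^ (specializeAt F x).natDegree *
                gdisc (specializeAt F x)‖) :=
              mul_le_mul_of_nonneg_left (by linarith) (Nat.cast_nonneg _)
          _ = _ := by ring
    _ = 3 * d ^ 2 * log 2 * (∑ x ∈ grid R, gridCount R x : ℕ) +
        7 * d * (∑ x ∈ grid R, (gridCount R x : ℝ) * logSize (specializeAt F x)) -
        4 * (∑ x ∈ grid R, (gridCount R x : ℝ) *
          log ‖(specializeAt F x).leadingCoeff ^ (specializeAt F x).natDegree‖) -
        ∑ x ∈ grid R, (gridCount R x : ℝ) *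
          log ‖(specializeAt F x).leadingCoeff ^ (specializeAt F x).natDegree *
            gdisc (specializeAt F x)‖ := by
        rw [Finset.sum_sub_distrib, Finset.sum_sub_distrib, Finset.sum_add_distrib,
          ← Finset.mul_sum, ← Finset.mul_sum, ← Finset.mul_sum, Nat.cast_sum]
    _ ≤ _ := by
        have h5 := mul_le_mul_of_nonneg_left h3 (by positivity : 0 ≤ 3 * (d : ℝ) ^ 2 * log 2)
        have h6 := mul_le_mul_of_nonneg_left h2 (by positivity : 0 ≤ 7 * (d : ℝ))
        linarith

/-- The logarithms in the explicit bound are absorbed in the factor `log (2 + n + M + d + τ + Λ)`.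
The hypothesis `1 ≤ M` gives `M ^ (n - 1) ≤ M ^ n`. -/
lemma explicit_bound_le (hn : 1 ≤ n) {M d : ℕ} (hM : 1 ≤ M) {Λ τ : ℝ} (hΛ : 0 ≤ Λ) (hτ : 0 ≤ τ) :
    3 * d ^ 2 * log 2 * M ^ n + 7 * d * (M ^ n * ((n + 1) * log (d + 1) + τ * log 2 +
        d * log (2 * n)) + d * M ^ (n - 1) * (n * (Λ * log 2) + 1)) +
        6 * d ^ 2 * (n * (M ^ (n - 1) * (Λ * log 2))) ≤
      31 * (d * M ^ n * (n + τ + d) + n * d ^ 2 * M ^ (n - 1) * Λ) *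
        logb 2 (2 + n + M + d + τ + Λ) ^ 1 * log 2 := by
  have hn' : (1 : ℝ) ≤ n := by exact_mod_cast hn
  have hM' : (1 : ℝ) ≤ M := by exact_mod_cast hM
  have hd : (0 : ℝ) ≤ d := Nat.cast_nonneg d
  have hlog2 := log_pos one_lt_two
  have h2log2 : 1 ≤ 2 * log 2 := by
    have := log_two_gt_d9
    linarith
  set s : ℝ := 2 + n + M + d + τ + Λ with hs
  rw [pow_one, mul_assoc (31 * _), show logb 2 s * log 2 = log s from div_mul_cancel₀ _ hlog2.ne']
  have h2s : log 2 ≤ log s := log_le_log two_pos (by linarith)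
  have hds : log (d + 1) ≤ log s := log_le_log (by linarith) (by linarith)
  have hns : log (2 * n) ≤ 2 * log s := by
    rw [log_mul two_ne_zero (by linarith)]
    have : log n ≤ log s := log_le_log (by linarith) (by linarith)
    linarith
  set m : ℝ := (M : ℝ) ^ (n - 1) with hm
  have hm0 : 0 ≤ m := by positivity
  have hMn : (M : ℝ) ^ n = m * M := by
    rw [hm, ← pow_succ, Nat.sub_add_cancel hn]
  have hmM : m ≤ (M : ℝ) ^ n := by
    rw [hMn]; exact le_mul_of_one_le_right hm0 hM'
  set N : ℝ := (M : ℝ) ^ n with hN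
  have hN0 : 0 ≤ N := by positivity
  have e1 : 3 * d ^ 2 * log 2 * N ≤ 3 * d ^ 2 * log s * N := by gcongr
  have e2 : ((n : ℝ) + 1) * log (d + 1) + τ * log 2 + d * log (2 * n) ≤
      (2 * n + τ + 2 * d) * log s := by
    have a1 : ((n : ℝ) + 1) * log (d + 1) ≤ (2 * n) * log s := by
      refine mul_le_mul (by linarith) hds (log_nonneg (by linarith)) (by linarith)
    have a2 : τ * log 2 ≤ τ * log s := by gcongr
    have a3 : d * log (2 * n) ≤ d * (2 * log s) := by gcongr
    linarith
  have e3 : 7 * d * (N * (((n : ℝ) + 1) * log (d + 1) + τ * log 2 + d * log (2 * n))) ≤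
      7 * d * (N * ((2 * n + τ + 2 * d) * log s)) := by gcongr
  have e4 : 7 * d * (d * m * 1) ≤ 7 * d * (d * N * (2 * log s)) := by
    have : 1 ≤ 2 * log s := by linarith
    gcongr
  have e5 : 13 * d ^ 2 * (n * (m * (Λ * log 2))) ≤ 13 * d ^ 2 * (n * (m * (Λ * log s))) := by gcongr
  have hs0 : 0 ≤ log s := by linarith
  have e6 : 0 ≤ d * N * (17 * n + 24 * τ) * log s := by positivity
  have e7 : 0 ≤ 18 * (n * d ^ 2 * m * Λ) * log s := by positivity
  linarith

lemma lGDisc_nonneg (f : ℂ[X]) : 0 ≤ lGDisc f :=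
  Finset.sum_nonneg fun _ _ => by positivity

lemma lsep_nonneg (f : ℂ[X]) : 0 ≤ lsep f :=
  Finset.sum_nonneg fun _ _ => by positivity

/-- The amortized bound for a nonnegative quantity satisfying the univariate estimate. -/
lemma finsum_rootMult_mul_le (hn : 1 ≤ n) {Fs : Fin n → ℤ[X]} (hFs : ∀ i, Fs i ≠ 0) {M d : ℕ}
    {Λ τ : ℝ} (hsize : ∀ i, HasSize (Fs i) M Λ) {F : MvPolynomial (Option (Fin n)) ℤ} (hF : F ≠ 0)
    (hFsize : MvHasSize F d τ) (q : ℂ[X] → ℝ) (hq0 : ∀ f, 0 ≤ q f)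
    (hq : ∀ f, q f * log 2 ≤ 3 * f.natDegree ^ 2 * log 2 + 7 * (f.natDegree * logSize f)
      - 4 * log ‖f.leadingCoeff ^ f.natDegree‖
      - log ‖f.leadingCoeff ^ f.natDegree * gdisc f‖) :
    ∑ᶠ x ∈ complexVariety (systemIdeal Fs),
        (rootMult (systemIdeal Fs) x : ℝ) * q (specialize F x) ≤
      31 * (d * M ^ n * (n + τ + d) + n * d ^ 2 * M ^ (n - 1) * Λ) *
        logb 2 (2 + n + M + d + τ + Λ) ^ 1 := by
  have hlog2 := log_pos one_lt_two
  have hΛ : ∀ i, log (Fs i).supNorm ≤ Λ * log 2 := fun i => (div_le_iff₀ hlog2).1 (hsize i).2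
  have hτ : log (mvSupNorm F) ≤ τ * log 2 := (div_le_iff₀ hlog2).1 hFsize.2
  have hΛ0 : 0 ≤ Λ := (logb_nonneg one_lt_two (one_le_supNorm (hFs ⟨0, hn⟩))).trans
    (hsize ⟨0, hn⟩).2
  have hτ0 : 0 ≤ τ := (logb_nonneg one_lt_two (by exact_mod_cast one_le_mvSupNorm hF)).trans
    hFsize.2
  rw [complexVariety_systemIdeal hFs, finsum_mem_coe_finset]
  rcases Nat.eq_zero_or_pos M with rfl | hM
  · -- Constant polynomials have no roots.
    have hgrid : grid (rootsIn ℂ Fs) = ∅ := by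
      refine Finset.eq_empty_of_forall_notMem fun x hx => ?_
      have h := mem_grid.1 hx ⟨0, hn⟩
      have hcard := card_rootsIn (K := ℂ) Fs ⟨0, hn⟩
      rw [Nat.le_zero.1 (hsize ⟨0, hn⟩).1, Multiset.card_eq_zero] at hcard
      simp [hcard] at h
    rw [hgrid, Finset.sum_empty]
    have hℓ : 0 ≤ logb 2 (2 + n + (0 : ℕ) + d + τ + Λ) := by
      refine logb_nonneg one_lt_two ?_
      have := Nat.cast_nonneg (α := ℝ) n
      have := Nat.cast_nonneg (α := ℝ) d
      push_cast
      linarith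
    positivity
  refine le_of_mul_le_mul_right ?_ hlog2
  refine le_trans ?_ (explicit_bound_le hn hM hΛ0 hτ0)
  refine le_trans ?_ (sum_gridCount_mul_le hn hFs (fun i => (hsize i).1) hΛ hF hFsize.1 hτ
    (fun f => q f * log 2) hq)
  rw [Finset.sum_mul]
  refine Finset.sum_le_sum fun x hx => ?_
  rw [mul_assoc]
  refine mul_le_mul_of_nonneg_right ?_ (mul_nonneg (hq0 _) hlog2.le)
  exact_mod_cast rootMult_le_gridCount hFs hx

end Amortized

end AmortizedBounds

end

theorem corollary2 :
    ∃ (C : ℝ) (k : ℕ), 0 < C ∧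
      ∀ (n : ℕ), 1 ≤ n → ∀ (M d : ℕ) (Λ τ : ℝ)
        (Fs : Fin n → Polynomial ℤ) (F : MvPolynomial (Option (Fin n)) ℤ),
        (∀ i, Fs i ≠ 0) →
        (∀ i, AmortizedBounds.HasSize (Fs i) M Λ) →
        F ≠ 0 →
        AmortizedBounds.MvHasSize F d τ →
        (AmortizedBounds.complexVariety (AmortizedBounds.systemIdeal Fs)).Finite ∧
        ∑ᶠ x ∈ AmortizedBounds.complexVariety (AmortizedBounds.systemIdeal Fs),
            (AmortizedBounds.rootMult (AmortizedBounds.systemIdeal Fs) x : ℝ) *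
              AmortizedBounds.lGDisc (AmortizedBounds.specialize F x)
          ≤ C * (d * M ^ n * (n + τ + d) + n * d ^ 2 * M ^ (n - 1) * Λ) *
              Real.logb 2 (2 + n + M + d + τ + Λ) ^ k ∧
        ∑ᶠ x ∈ AmortizedBounds.complexVariety (AmortizedBounds.systemIdeal Fs),
            (AmortizedBounds.rootMult (AmortizedBounds.systemIdeal Fs) x : ℝ) *
              AmortizedBounds.lsep (AmortizedBounds.specialize F x)
          ≤ C * (d * M ^ n * (n + τ + d) + n * d ^ 2 * M ^ (n - 1) * Λ) *
              Real.logb 2 (2 + n + M + d + τ + Λ) ^ k := by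
  refine ⟨31, 1, by norm_num, fun n hn M d Λ τ Fs F hFs hsize hF hFsize => ⟨?_, ?_, ?_⟩⟩
  · rw [AmortizedBounds.complexVariety_systemIdeal hFs]
    exact Finset.finite_toSet _
  · exact AmortizedBounds.finsum_rootMult_mul_le hn hFs hsize hF hFsize _
      AmortizedBounds.lGDisc_nonneg AmortizedBounds.lGDisc_le
  · exact AmortizedBounds.finsum_rootMult_mul_le hn hFs hsize hF hFsize _
      AmortizedBounds.lsep_nonneg AmortizedBounds.lsep_le
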